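/- Let $k$ be a field, $R$ a commutative $k$-algebra and $\mathfrak{D}=\mathrm{Der}_k(R)$ the $R$-module of $k$-derivations of $R$. **Trees.** Let $H=k\mathcal{LT}(\mathfrak{D})$ be the $k$-vector space whose basis is the set of finite rooted ordered trees in which every node other than the root is labeled with an element of $\mathfrak{D}$. For a tree $T$ let $\mathcal{F}(T)$ be the ordered list of branches at the root of $T$ and, for a subset $X$ of these branches, let $T_X$ be the tree whose branches at the root are those in $X$, in their original order. $H$ is the cocommutative $k$-Hopf algebra with $$T_1\cdot T_2=\sum_d T_d,\qquad \Delta(T)=\sum_{X\subseteq\mathcal{F}(T)}T_X\otimes T_{\mathcal{F}(T)\setminus X},\qquad \varepsilon(1)=1,\quad \varepsilon(T)=0\ (T\neq 1),$$ where $1$ is the tree with a single node, $d$ runs over all maps from $\mathcal{F}(T_1)$ to the set of nodes of $T_2$, and $T_d$ is obtained by linking each branch $b$ of $T_1$ to the node $d(b)$ of $T_2$, the branches linked to a node preceding its old children and keeping the order they had in $T_1$. Its antipode $S$ is determined by $S(1)=1$ and $S(T)=-\sum_{X\subsetneq\mathcal{F}(T)}S(T_X)\cdot T_{\mathcal{F}(T)\setminus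 X}$ for trees $T\ne 1$. **Leibnitz module algebras.** For a tree $T$ and a non-root node $i$ of $T$, let $T_i$ be the subtree whose (now unlabeled) root is $i$; for $F\in\mathfrak{D}$ and a tree $T'$ let $T(i,F,T')$ be the tree obtained from $T$ by relabeling $i$ with $F$ and replacing the subtree rooted at $i$ by $T'$; extend this linearly in $T'$. $R$ is an *$H$-module algebra* if it is a left $H$-module (compatibly with its $k$-vector space structure) such that $h\cdot(rs)=\sum(h_{(1)}\cdot r)(h_{(2)}\cdot s)$ for all $h\in H$, $r,s\in R$. It is *Leibnitz* if $$T\cdot s=\sum_{(T_i)}({T_i}_{(1)}\cdot r)\,\bigl(T(i,E,{T_i}_{(2)})\cdot s\bigr)$$ for all $s\in R$, all trees $T$, all non-root nodes $i$ of $T$ and all $r\in R$, $E\in\mathfrak{D}$ such that the label of $i$ is $rE$. **The smash product.** Let $B=R\rtimes H$ be $R\otimes_kH$, with $r\# h=r\otimes h$ and with $$(r\# h)(s\# g)=\sum r(h_{(1)}\cdot s)\# h_{(2)}g,\quad \Delta(r\# h)=\sum(r\# h_{(1)})\otimes_R(1\# h_{(2)}),\quad \varepsilon(r\# h)=r\,\varepsilon(h),\quad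 E(r\# h)=\sum(r\# h_{(1)})\otimes_{\mathrm r}(1\# S(h_{(2)})).$$ Here $\otimes_R$ is formed with the left $R$-module structures on both factors, and $\otimes_{\mathrm r}$ with the right $R$-module structure on the first factor (right multiplication by $r\# 1$) and the left one on the second. An *$R/k$-Hopf ideal* of $B$ is a two-sided ideal $I$ such that, with $\pi:B\to B/I$ the projection, $\varepsilon(I)=0$, $(\pi\otimes_R\pi)\circ\Delta(I)=0$ and $(\pi\otimes_{\mathrm r}\pi)\circ E(I)=0$. **Proposition.** Suppose that $R$ is a Leibnitz $H$-module algebra, and let $\mathcal{I}\subseteq B$ be the (left) $R$-linear span of all elements $$1\# T-\sum_{(T_i)}({T_i}_{(1)}\cdot r)\#T(i,E,{T_i}_{(2)}),$$ where $T$ is a tree, $i$ is a non-root node of $T$, and $r\in R$, $E\in\mathfrak{D}$ are such that the label of $i$ is $rE$. Then $\mathcal{I}$ is an $R/k$-Hopf ideal of $B$. -/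

import Mathlib

open scoped TensorProduct

namespace TreeHopf

/-! ## Labeled ordered trees

An ordered tree whose non root nodes are labeled with elements of `D` (and whose root is not
labeled) is the same thing as the ordered list of the branches hanging from its root.
It is encoded by its leftmost-child / right-sibling form. -/

/-- The set of ordered trees in which every node except the root is labeled with an element
of `D`.
* `nil` is the tree whose only node is the (unlabeled) root;
* `cons E C G` is the tree whose root has as first child a node labeled `E`; the labeled ordered
  subtree rooted at that first child is `C`; the remaining branches at the root are those of `G`.
-/
inductive LTree (D : Type*) where
  | nil : LTree D
  | cons (E : D) (C G : LTree D) : LTree D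

namespace LTree

variable {D : Type*}

/-- The number of children of the root. -/
def length : LTree D → ℕ
  | nil => 0
  | cons _ _ G => G.length + 1

/-- The tree `t(S, T)` obtained by identifying the roots of `S` and `T`, the children of the root
of `S` preceding those of the root of `T`. -/
def append : LTree D → LTree D → LTree D
  | nil, T => T
  | cons E C G, T => cons E C (append G T)

/-- All the pairs `(T_X, T_{F \ X})`, where `F` is the ordered multiset of the branches at the root
of `T` and `X` runs over the `2 ^ |F|` ways of choosing some of these branches; orders and labels
are preserved. -/
def splits : LTree D → Multiset (LTree D × LTree D)
  | nil => {(nil, nil)}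
  | cons E C G =>
      (splits G).map (fun p => (cons E C p.1, p.2)) + (splits G).map (fun p => (p.1, cons E C p.2))

/-- `linkBelow S T`: all the trees obtained by linking every branch at the root of `S` to some node
of `T` other than the root.  Branches linked to a node are put before the old children of that
node, in the order which they had in `S`.

If `T = cons E C G`, the branches of `S` are distributed as follows: `A` is linked to the first
child of the root of `T`, `A'` to nodes strictly below this child, and `Q` to non root nodes
of `G`. -/
def linkBelow : LTree D → LTree D → Multiset (LTree D)
  | nil, nil => {nil}
  | cons _ _ _, nil => 0
  | S, cons E C G =>
      (splits S).bind fun (P, Q) =>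
        (splits P).bind fun (A, A') =>
          (linkBelow A' C).bind fun C' =>
            (linkBelow Q G).map fun G' => cons E (append A C') G'

/-- All the trees `T_d` obtained by linking the branches at the root of `S` to nodes of `T` (the
root included) according to a map `d` from these branches to the nodes of `T`; one
entry for each `d`.  Here `A` is the part of `S` linked to the root of `T`. -/
def graftings (S T : LTree D) : Multiset (LTree D) :=
  (splits S).bind fun (A, B) => (linkBelow B T).map fun T' => append A T'

/-- The non root nodes of a tree. -/
inductive Node : LTree D → Type _ where
  | here {E : D} {C G : LTree D} : Node (cons E C G)
  | child {E : D} {C G : LTree D} (i : Node C) : Node (cons E C G)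
  | sibling {E : D} {C G : LTree D} (i : Node G) : Node (cons E C G)

/-- The label of a non root node. -/
def Node.label : {T : LTree D} → Node T → D
  | cons E _ _, .here => E
  | cons _ _ _, .child i => i.label
  | cons _ _ _, .sibling i => i.label

/-- The labeled ordered subtree `T_i` whose (now unlabeled) root is the node `i`. -/
def Node.subtree : {T : LTree D} → Node T → LTree D
  | cons _ C _, .here => C
  | cons _ _ _, .child i => i.subtree
  | cons _ _ _, .sibling i => i.subtree

/-- The tree `T(i, F, T')`: as `T`, except that the node `i` is labeled with `F` and that the
labeled ordered subtree rooted at `i` is `T'`. -/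
def Node.replace : {T : LTree D} → Node T → D → LTree D → LTree D
  | cons _ _ G, .here, F, T' => cons F T' G
  | cons E _ G, .child i, F, T' => cons E (i.replace F T') G
  | cons E C _, .sibling i, F, T' => cons E C (i.replace F T')

end LTree

/-! ## The Hopf algebra of trees -/

/-- The vector space over `k` with basis the set of labeled ordered trees. -/
def KLT (k D : Type*) [Field k] : Type _ := LTree D →₀ k

namespace KLT

variable {k D : Type*} [Field k]

noncomputable instance : AddCommGroup (KLT k D) := inferInstanceAs (AddCommGroup (LTree D →₀ k))
noncomputable instance : Module k (KLT k D) := inferInstanceAs (Module k (LTree D →₀ k))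

/-- The basis element given by a tree. -/
noncomputable def tree (k : Type*) {D : Type*} [Field k] (T : LTree D) : KLT k D :=
  Finsupp.single T (1 : k)

/-- The linear map with prescribed values on the basis of trees. -/
noncomputable def extend {M : Type*} [AddCommGroup M] [Module k M] (f : LTree D → M) :
    KLT k D →ₗ[k] M :=
  Finsupp.linearCombination k f

@[simp] theorem extend_tree {M : Type*} [AddCommGroup M] [Module k M] (f : LTree D → M)
    (T : LTree D) : extend f (tree k T) = f T := by
  exact (Finsupp.linearCombination_single k (1 : k) T).trans (one_smul k _)

/-- The bilinear product, with `S · T = ∑_d T_d` for trees `S` and `T`. -/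
noncomputable def mulMap : KLT k D →ₗ[k] KLT k D →ₗ[k] KLT k D :=
  extend fun S => extend fun T => ((LTree.graftings S T).map (tree k)).sum

noncomputable instance : Mul (KLT k D) := ⟨fun g h => mulMap g h⟩

/-- The unit is the tree with only one node. -/
noncomputable instance : One (KLT k D) := ⟨tree k LTree.nil⟩

/-- The coproduct, with `Δ T = ∑_X T_X ⊗ T_{F \ X}` for a tree `T`. -/
noncomputable def comul : KLT k D →ₗ[k] KLT k D ⊗[k] KLT k D :=
  extend fun T => ((LTree.splits T).map fun p => tree k p.1 ⊗ₜ[k] tree k p.2).sum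

/-- The counit: `1` on the one-node tree and `0` on every other tree. -/
noncomputable def counit : KLT k D →ₗ[k] k :=
  extend fun T => match T with
    | LTree.nil => 1
    | LTree.cons _ _ _ => 0

/-- The antipode on trees, given by the usual recursion in a graded connected bialgebra: `S(1) = 1`
and `S(T) = - ∑ S(T_X) · T_{F \ X}` for `T ≠ 1`, the sum being over all choices `X` of branches
different from the choice of all of them.  This is the equation `∑ S(T_(1)) · T_(2) = ε(T) 1`
solved for `S(T)`. -/
noncomputable def antipodeTree : LTree D → KLT k D
  | LTree.nil => 1
  | LTree.cons E C G =>
      - (((LTree.splits (LTree.cons E C G)).filter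
            fun p => p.1.length < (LTree.cons E C G).length).attach.map
          fun p => antipodeTree p.1.1 * tree k p.1.2).sum
termination_by T => T.length
decreasing_by exact (Multiset.mem_filter.1 p.2).2

/-- The antipode of the Hopf algebra of trees. -/
noncomputable def antipode : KLT k D →ₗ[k] KLT k D := extend antipodeTree

end KLT

/-! ## Module algebras over the Hopf algebra of trees -/

section Action

variable {k R : Type*} [Field k] [CommRing R] [Algebra k R]

/-- The `k`-linear map `ρ` (with `h · r = ρ h r`) makes `R` a left module over the tree algebra, and
`h · (r s) = ∑ (h_(1) · r) (h_(2) · s)`.  (The identity `h · 1 = ε(h) 1` is a consequence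
of this, by induction on the number of children of the root.) -/
structure IsModuleAlgebra {D : Type*} (ρ : KLT k D →ₗ[k] R →ₗ[k] R) : Prop where
  one_act : ∀ r : R, ρ 1 r = r
  mul_act : ∀ (g h : KLT k D) (r : R), ρ (g * h) r = ρ g (ρ h r)
  act_mul : ∀ (h : KLT k D) (r s : R),
    ρ h (r * s) = LinearMap.mul' k R (TensorProduct.map (ρ.flip r) (ρ.flip s) (KLT.comul h))

/-- The module algebra structure `ρ` of `R` over the Hopf algebra of trees labeled with derivations
of `R` is *Leibnitz*: `T · s = ∑ (T_i(1) · r) (T(i, E, T_i(2)) · s)` for all trees `T`, all non root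
nodes `i` of `T` and all factorizations `r E` of the label of `i`. -/
structure IsLeibnitz (ρ : KLT k (Derivation k R R) →ₗ[k] R →ₗ[k] R) : Prop
    extends IsModuleAlgebra ρ where
  leibnitz : ∀ (T : LTree (Derivation k R R)) (i : T.Node) (r : R) (E : Derivation k R R),
    i.label = r • E → ∀ s : R,
      ρ (KLT.tree k T) s = (i.subtree.splits.map fun p =>
        ρ (KLT.tree k p.1) r * ρ (KLT.tree k (i.replace E p.2)) s).sum

end Action

/-! ## The smash product, as an `R/k`-Hopf algebra -/

section Smash

variable {k R D : Type*} [Field k] [CommRing R] [Algebra k R]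

/-- The space underlying the smash product of `R` and the algebra of trees; `r # h` is `r ⊗ₜ h`. -/
abbrev Smash (k R D : Type*) [Field k] [CommRing R] [Algebra k R] : Type _ := R ⊗[k] KLT k D

/-- Left multiplication by `1 # h`, that is, `s # g ↦ ∑ (h_(1) · s) # h_(2) g`. -/
noncomputable def hopfMul (ρ : KLT k D →ₗ[k] R →ₗ[k] R) :
    KLT k D →ₗ[k] Smash k R D →ₗ[k] Smash k R D :=
  TensorProduct.lift ((TensorProduct.mapBilinear (RingHom.id k) R (KLT k D) R (KLT k D)).compl₁₂
    ρ KLT.mulMap) ∘ₗ KLT.comul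

/-- The product of the smash product, `(r # h) (s # g) = ∑ r (h_(1) · s) # h_(2) g`. -/
noncomputable def smashMul (ρ : KLT k D →ₗ[k] R →ₗ[k] R) :
    Smash k R D →ₗ[k] Smash k R D →ₗ[k] Smash k R D :=
  TensorProduct.lift ((LinearMap.mul k (Module.End k (Smash k R D))).compl₁₂
    (Algebra.lsmul k k (Smash k R D)).toLinearMap (hopfMul ρ))

/-- The product formula for trees. -/
theorem smashMul_tree (ρ : KLT k D →ₗ[k] R →ₗ[k] R) (r s : R) (T : LTree D) (g : KLT k D) :
    smashMul ρ (r ⊗ₜ KLT.tree k T) (s ⊗ₜ g) =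
      (T.splits.map fun p => (r * ρ (KLT.tree k p.1) s) ⊗ₜ[k] (KLT.tree k p.2 * g)).sum := by
  have h : hopfMul ρ (KLT.tree k T) (s ⊗ₜ g) =
      (T.splits.map fun p => (ρ (KLT.tree k p.1) s) ⊗ₜ[k] (KLT.tree k p.2 * g)).sum := by
    simp only [hopfMul, KLT.comul, LinearMap.comp_apply, KLT.extend_tree]
    induction T.splits using Multiset.induction_on with
    | empty => simp
    | cons a m ih => simp_all; rfl
  simp only [smashMul, TensorProduct.lift.tmul, LinearMap.compl₁₂_apply, LinearMap.mul_apply',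
    Module.End.mul_apply, h]
  simp only [AlgHom.toLinearMap_apply, Algebra.lsmul_coe]
  induction T.splits using Multiset.induction_on with
  | empty => simp
  | cons a m ih => simp_all [smul_add, TensorProduct.smul_tmul']

/-- The coproduct `r # h ↦ ∑ (r # h_(1)) ⊗ (1 # h_(2))`.  The tensor product over `R` is formed with
the left `R`-module structures. -/
noncomputable def smashComul : Smash k R D →ₗ[R] Smash k R D ⊗[R] Smash k R D :=
  LinearMap.liftBaseChange R (TensorProduct.lift
    (((TensorProduct.mk R (Smash k R D) (Smash k R D)).restrictScalars₁₂ k k).compl₁₂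
      (TensorProduct.mk k R (KLT k D) 1) (TensorProduct.mk k R (KLT k D) 1)) ∘ₗ KLT.comul)

/-- The counit `r # h ↦ r ε(h)`. -/
noncomputable def smashCounit : Smash k R D →ₗ[R] R :=
  LinearMap.liftBaseChange R (Algebra.linearMap k R ∘ₗ KLT.counit)

/-- Let `B` be the smash product and `π : B → Q` a `k`-linear map.  These are the relations
`(b r) ⊗ c = b ⊗ (r c)`, transported to `Q ⊗ Q` by `π`; here `b r` is the product `b (r # 1)`. -/
def balancing (ρ : KLT k D →ₗ[k] R →ₗ[k] R) {Q : Type*} [AddCommGroup Q] [Module k Q]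
    (π : Smash k R D →ₗ[k] Q) : Submodule k (Q ⊗[k] Q) :=
  Submodule.span k {z | ∃ (b c : Smash k R D) (r : R),
    z = π (smashMul ρ b (r ⊗ₜ[k] (1 : KLT k D))) ⊗ₜ[k] π c - π b ⊗ₜ[k] π (r • c)}

/-- The tensor product `Q ⊗_r Q` which uses the right `R`-module structure of the first factor and
the left `R`-module structure of the second one, for a quotient `π : B → Q` of the smash product `B`
with the `R`-`R`-bimodule structure induced from `B`.  For `π = id` this is `B ⊗_r B`. -/
abbrev BTensor (ρ : KLT k D →ₗ[k] R →ₗ[k] R) {Q : Type*} [AddCommGroup Q] [Module k Q]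
    (π : Smash k R D →ₗ[k] Q) : Type _ := (Q ⊗[k] Q) ⧸ balancing ρ π

/-- The map `π ⊗_r π : B ⊗_r B → Q ⊗_r Q`. -/
noncomputable def BTensor.map (ρ : KLT k D →ₗ[k] R →ₗ[k] R) {Q : Type*} [AddCommGroup Q]
    [Module k Q] (π : Smash k R D →ₗ[k] Q) :
    BTensor ρ (LinearMap.id : Smash k R D →ₗ[k] Smash k R D) →ₗ[k] BTensor ρ π :=
  Submodule.mapQ _ _ (TensorProduct.map π π) (by
    refine Submodule.span_le.2 ?_
    rintro z ⟨b, c, r, rfl⟩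
    exact Submodule.subset_span ⟨b, c, r, by simp⟩)

/-- The antiproduct `r # h ↦ ∑ (r # h_(1)) ⊗_r (1 # S(h_(2)))`. -/
noncomputable def antiproduct (ρ : KLT k D →ₗ[k] R →ₗ[k] R) :
    Smash k R D →ₗ[k] BTensor ρ (LinearMap.id : Smash k R D →ₗ[k] Smash k R D) :=
  Submodule.mkQ _ ∘ₗ
    TensorProduct.map LinearMap.id (TensorProduct.mk k R (KLT k D) 1 ∘ₗ KLT.antipode) ∘ₗ
    (TensorProduct.assoc k R (KLT k D) (KLT k D)).symm.toLinearMap ∘ₗ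
    TensorProduct.map LinearMap.id KLT.comul

/-- `I` is an `R/k`-Hopf ideal of the smash product `B`: it is a two-sided ideal (a left and
right `B`-stable `R`-submodule), `ε(I) = 0`, and, with `π : B → B / I` the projection,
`(π ⊗_R π) ∘ Δ` and `(π ⊗_r π) ∘ E` vanish on `I`, where `E` is the antiproduct. -/
structure IsHopfIdeal (ρ : KLT k D →ₗ[k] R →ₗ[k] R) (I : Submodule R (Smash k R D)) : Prop where
  mul_mem_left : ∀ b x : Smash k R D, x ∈ I → smashMul ρ b x ∈ I
  mul_mem_right : ∀ x b : Smash k R D, x ∈ I → smashMul ρ x b ∈ I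
  counit_eq_zero : ∀ x ∈ I, smashCounit x = 0
  comul_eq_zero : ∀ x ∈ I, TensorProduct.map I.mkQ I.mkQ (smashComul x) = 0
  antiproduct_eq_zero : ∀ x ∈ I,
    BTensor.map ρ (I.mkQ.restrictScalars k) (antiproduct ρ x) = 0

/-- The `R`-linear span of the elements `1 # T - ∑ (T_i(1) · r) # T(i, E, T_i(2))`, where `T` is a
tree and `i` a non root node of `T`, and `r E` any factorization of the label of `i`. -/
noncomputable def leibnitzIdeal (ρ : KLT k (Derivation k R R) →ₗ[k] R →ₗ[k] R) :
    Submodule R (Smash k R (Derivation k R R)) :=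
  Submodule.span R {z | ∃ (T : LTree (Derivation k R R)) (i : T.Node) (r : R)
    (E : Derivation k R R), i.label = r • E ∧
      z = 1 ⊗ₜ[k] KLT.tree k T - (i.subtree.splits.map fun p =>
        ρ (KLT.tree k p.1) r ⊗ₜ[k] KLT.tree k (i.replace E p.2)).sum}

end Smash

end TreeHopf

/-! For a function `φ` on trees, its `defect` at a marked node is the value of `φ` on the tree with
label `r • E` there, minus the Leibnitz expansion of that value. The ideal is the `R`-span of the
defects of `T ↦ 1 # T`, so every claim is about how defects pass through a structure map. A tree
with a marked node is handled as a context (`TreeCtx`) whose open node receives a label and a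
subtree.

Cutting a tree at its root leaves the marked node on exactly one side, so the defect of a sum over
cuts is a sum of defects in a single factor (`defect_splitSum`); this settles the coproduct. The
counit vanishes because all trees involved are nontrivial.

Under left multiplication by `1 # U`, each branch of `U` lands either in the marked subtree or
outside it. Multiplicativity of the coproduct and the module algebra axioms then turn the product
with a defect into a sum of defects (`splitSum_defect`, `hopfMul_defect`). Under right
multiplication by `s # V`, either the part with the marked node acts on `s`, and the defect is zero
because `R` is Leibnitz, or that part is grafted onto `V`, which only enlarges the context
(`isContextual_graftings`, `defect_graftSum_mem`).

The antiproduct needs a twisted Leibnitz rule for the antipode modulo the ideal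
(`antipode_sub_mem`): branches `Y` cut off from the context act on the coefficient through `S(Y)`.
The same twist appears when a left scalar `t` on the first factor of the balanced tensor product is
moved to the second one, because `t # T = ∑ (1 # T_(1)) (S(T_(2)) · t # 1)`
(`splitSum_smashMul_antipode`). The two twists match, by `defect_pairing_eq_zero`. -/

namespace TreeHopf

namespace LTree

variable {D M N : Type*} [AddCommMonoid M] [AddCommMonoid N]

/-! ## Sums over the parts and the graftings of trees -/

/-- The sum of `f T_X T_{F \ X}` over all sets `X` of branches at the root of `T`. -/
def splitSum (T : LTree D) (f : LTree D → LTree D → M) : M :=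
  ((splits T).map fun p => f p.1 p.2).sum

/-- The sum of `f` over all trees in `linkBelow S T`. -/
def linkSum (S T : LTree D) (f : LTree D → M) : M := ((linkBelow S T).map f).sum

/-- The sum of `f` over all trees in `graftings S T`. -/
def graftSum (S T : LTree D) (f : LTree D → M) : M := ((graftings S T).map f).sum

theorem splitSum_add (T : LTree D) (f g : LTree D → LTree D → M) :
    splitSum T (fun P Q => f P Q + g P Q) = splitSum T f + splitSum T g :=
  Multiset.sum_map_add

theorem splitSum_sub {M : Type*} [AddCommGroup M] (T : LTree D) (f g : LTree D → LTree D → M) :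
    splitSum T (fun P Q => f P Q - g P Q) = splitSum T f - splitSum T g :=
  Multiset.sum_map_sub

theorem splitSum_mem {S : Type*} [SetLike S M] [AddSubmonoidClass S M] {I : S} (T : LTree D)
    {f : LTree D → LTree D → M} (h : ∀ P Q, f P Q ∈ I) : splitSum T f ∈ I := by
  refine multiset_sum_mem _ fun x hx => ?_
  obtain ⟨p, -, rfl⟩ := Multiset.mem_map.1 hx
  exact h _ _

theorem graftSum_mem {A : Type*} [SetLike A M] [AddSubmonoidClass A M] {I : A} (S T : LTree D)
    {f : LTree D → M} (h : ∀ U, f U ∈ I) : graftSum S T f ∈ I := by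
  refine multiset_sum_mem _ fun x hx => ?_
  obtain ⟨p, -, rfl⟩ := Multiset.mem_map.1 hx
  exact h _

@[simp] theorem splitSum_zero (T : LTree D) : splitSum T (fun _ _ => (0 : M)) = 0 :=
  Multiset.sum_map_zero

theorem linkSum_add (S T : LTree D) (f g : LTree D → M) :
    linkSum S T (fun U => f U + g U) = linkSum S T f + linkSum S T g :=
  Multiset.sum_map_add

@[simp] theorem linkSum_zero (S T : LTree D) : linkSum S T (fun _ => (0 : M)) = 0 :=
  Multiset.sum_map_zero

theorem graftSum_add (S T : LTree D) (f g : LTree D → M) :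
    graftSum S T (fun U => f U + g U) = graftSum S T f + graftSum S T g :=
  Multiset.sum_map_add

theorem graftSum_sub {M : Type*} [AddCommGroup M] (S T : LTree D) (f g : LTree D → M) :
    graftSum S T (fun U => f U - g U) = graftSum S T f - graftSum S T g :=
  Multiset.sum_map_sub

theorem map_splitSum {F : Type*} [FunLike F M N] [AddMonoidHomClass F M N] (φ : F) (T : LTree D)
    (f : LTree D → LTree D → M) : φ (splitSum T f) = splitSum T fun P Q => φ (f P Q) := by
  simp [splitSum, map_multiset_sum, Multiset.map_map]

theorem splitSum_neg {M : Type*} [AddCommGroup M] (T : LTree D) (f : LTree D → LTree D → M) :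
    splitSum T (fun P Q => - f P Q) = - splitSum T f :=
  (map_splitSum (negAddMonoidHom (α := M)) T f).symm

theorem map_graftSum {F : Type*} [FunLike F M N] [AddMonoidHomClass F M N] (φ : F) (S T : LTree D)
    (f : LTree D → M) : φ (graftSum S T f) = graftSum S T fun U => φ (f U) := by
  simp [graftSum, map_multiset_sum, Multiset.map_map]

theorem splitSum_comm (S T : LTree D) (f : LTree D → LTree D → LTree D → LTree D → M) :
    splitSum S (fun A B => splitSum T fun P Q => f A B P Q) =
      splitSum T fun P Q => splitSum S fun A B => f A B P Q :=
  Multiset.sum_map_sum_map _ _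

theorem linkSum_splitSum_comm (S U T : LTree D) (f : LTree D → LTree D → LTree D → M) :
    linkSum S U (fun A => splitSum T fun P Q => f A P Q) =
      splitSum T fun P Q => linkSum S U fun A => f A P Q :=
  Multiset.sum_map_sum_map _ _

theorem graftSum_splitSum_comm (S U T : LTree D) (f : LTree D → LTree D → LTree D → M) :
    graftSum S U (fun A => splitSum T fun P Q => f A P Q) =
      splitSum T fun P Q => graftSum S U fun A => f A P Q :=
  Multiset.sum_map_sum_map _ _

theorem linkSum_comm (S U T V : LTree D) (f : LTree D → LTree D → M) :
    linkSum S U (fun A => linkSum T V fun P => f A P) =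
      linkSum T V fun P => linkSum S U fun A => f A P :=
  Multiset.sum_map_sum_map _ _

theorem graftSum_comm (S U T V : LTree D) (f : LTree D → LTree D → M) :
    graftSum S U (fun A => graftSum T V fun P => f A P) =
      graftSum T V fun P => graftSum S U fun A => f A P :=
  Multiset.sum_map_sum_map _ _

theorem graftSum_linkSum_comm (S U T V : LTree D) (f : LTree D → LTree D → M) :
    graftSum S U (fun A => linkSum T V fun P => f A P) =
      linkSum T V fun P => graftSum S U fun A => f A P :=
  Multiset.sum_map_sum_map _ _

@[simp] theorem splitSum_nil (f : LTree D → LTree D → M) : splitSum nil f = f nil nil := by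
  simp [splitSum, splits]

theorem splitSum_cons (E : D) (C G : LTree D) (f : LTree D → LTree D → M) :
    splitSum (cons E C G) f =
      splitSum G (fun P Q => f (cons E C P) Q) + splitSum G fun P Q => f P (cons E C Q) := by
  simp [splitSum, splits, Multiset.map_map]

/-- Cocommutativity. -/
theorem splitSum_swap (T : LTree D) (f : LTree D → LTree D → M) :
    splitSum T f = splitSum T fun P Q => f Q P := by
  induction T generalizing f with
  | nil => simp
  | cons E C G _ ih =>
    rw [splitSum_cons, splitSum_cons, ih, add_comm, ih fun P Q => f P (cons E C Q)]

/-- Coassociativity. -/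
theorem splitSum_assoc (T : LTree D) (f : LTree D → LTree D → LTree D → M) :
    splitSum T (fun P Q => splitSum P fun A B => f A B Q) =
      splitSum T fun P Q => splitSum Q fun A B => f P A B := by
  induction T generalizing f with
  | nil => simp
  | cons E C G _ ih =>
    simp only [splitSum_cons, splitSum_add, ih, add_assoc]

theorem splitSum_left_comm (T : LTree D) (f : LTree D → LTree D → LTree D → M) :
    splitSum T (fun P Q => splitSum Q fun A B => f P A B) =
      splitSum T fun P Q => splitSum Q fun A B => f A P B := by
  rw [← splitSum_assoc, ← splitSum_assoc]
  congr! 3 with P Q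
  rw [splitSum_swap]

/-- The interchange of the two middle parts of a tree cut into four. -/
theorem splitSum_interchange (T : LTree D) (f : LTree D → LTree D → LTree D → LTree D → M) :
    splitSum T (fun P Q => splitSum P fun A B => splitSum Q fun A' B' => f A B A' B') =
      splitSum T fun P Q => splitSum P fun A A' => splitSum Q fun B B' => f A B A' B' := by
  rw [splitSum_assoc T fun A B Q => splitSum Q fun A' B' => f A B A' B',
    splitSum_assoc T fun A A' Q => splitSum Q fun B B' => f A B A' B']
  congr! 3 with P Q
  rw [splitSum_left_comm]

/-- All parts except the pair `(T, 1)` have a nontrivial second component. -/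
theorem exists_splits_eq_cons_right (T : LTree D) :
    ∃ m : Multiset (LTree D × LTree D), splits T = (T, nil) ::ₘ m ∧
      ∀ p ∈ m, p.2 ≠ nil ∧ p.1.length < T.length := by
  have hlen : ∀ T : LTree D, ∀ p ∈ splits T, p.1.length ≤ T.length := by
    intro T
    induction T with
    | nil => simp [splits]
    | cons E C G _ ih =>
      simp only [splits, Multiset.mem_add, Multiset.mem_map]
      rintro p (⟨q, hq, rfl⟩ | ⟨q, hq, rfl⟩)
      · simpa [length] using ih q hq
      · exact (ih q hq).trans (by simp [length])
  induction T with
  | nil => exact ⟨0, by simp [splits]⟩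
  | cons E C G _ ih =>
    obtain ⟨m, hm, h⟩ := ih
    refine ⟨m.map (fun p => (cons E C p.1, p.2)) +
      (splits G).map (fun p => (p.1, cons E C p.2)), ?_, ?_⟩
    · conv_lhs => rw [splits]
      nth_rewrite 1 [hm]
      simp
    · simp only [Multiset.mem_add, Multiset.mem_map]
      rintro p (⟨q, hq, rfl⟩ | ⟨q, hq, rfl⟩)
      · simpa [length] using h q hq
      · simpa [length, Nat.lt_succ_iff] using hlen G q hq

theorem splitSum_eq_of_right {T : LTree D} {f : LTree D → LTree D → M}
    (h : ∀ P Q, Q ≠ nil → f P Q = 0) : splitSum T f = f T nil := by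
  obtain ⟨m, hm, h'⟩ := exists_splits_eq_cons_right T
  rw [splitSum, hm, Multiset.map_cons, Multiset.sum_cons, Multiset.sum_eq_zero, add_zero]
  simp only [Multiset.mem_map]
  rintro x ⟨p, hp, rfl⟩
  exact h _ _ (h' p hp).1

theorem splitSum_eq_of_left {T : LTree D} {f : LTree D → LTree D → M}
    (h : ∀ P Q, P ≠ nil → f P Q = 0) : splitSum T f = f nil T := by
  rw [splitSum_swap]
  exact splitSum_eq_of_right fun P Q => h Q P

/-! ### Juxtaposition, linking, and multiplicativity of the coproduct. -/

@[simp] theorem nil_append (T : LTree D) : append nil T = T := rfl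

@[simp] theorem cons_append (E : D) (C G T : LTree D) :
    append (cons E C G) T = cons E C (append G T) := rfl

@[simp] theorem append_nil (T : LTree D) : append T nil = T := by
  induction T with
  | nil => rfl
  | cons E C G _ ih => rw [cons_append, ih]

theorem append_assoc (S T U : LTree D) : append (append S T) U = append S (append T U) := by
  induction S with
  | nil => rfl
  | cons E C G _ ih => simp [ih]

@[simp] theorem linkSum_nil_nil (f : LTree D → M) : linkSum nil nil f = f nil := by
  simp [linkSum, linkBelow]

@[simp] theorem linkSum_cons_nil (E : D) (C G : LTree D) (f : LTree D → M) :
    linkSum (cons E C G) nil f = 0 := by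
  simp [linkSum, linkBelow]

theorem linkSum_nil_of_ne {S : LTree D} (h : S ≠ nil) (f : LTree D → M) : linkSum S nil f = 0 := by
  cases S with
  | nil => exact (h rfl).elim
  | cons E C G => simp

theorem graftSum_eq (S T : LTree D) (f : LTree D → M) :
    graftSum S T f = splitSum S fun A B => linkSum B T fun T' => f (append A T') := by
  simp [graftSum, splitSum, linkSum, graftings, Multiset.map_bind, Multiset.sum_bind]

/-- The branches sent to the first child and those sent strictly below it together form one grafting
onto `C`, so the two inner cuts of `linkBelow` merge into a single `graftSum`. -/
theorem linkSum_cons (S : LTree D) (E : D) (C G : LTree D) (f : LTree D → M) :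
    linkSum S (cons E C G) f = splitSum S fun P Q => graftSum P C fun C' =>
      linkSum Q G fun G' => f (cons E C' G') := by
  simp only [graftSum_eq]
  simp [splitSum, linkSum, linkBelow, Multiset.map_bind, Multiset.sum_bind]

@[simp] theorem linkSum_nil (T : LTree D) (f : LTree D → M) : linkSum nil T f = f T := by
  induction T generalizing f with
  | nil => simp
  | cons E C G ihC ihG => simp [linkSum_cons, graftSum_eq, ihC, ihG]

@[simp] theorem graftSum_nil (T : LTree D) (f : LTree D → M) : graftSum nil T f = f T := by
  simp [graftSum_eq]

@[simp] theorem graftSum_nil_right (T : LTree D) (f : LTree D → M) : graftSum T nil f = f T := by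
  rw [graftSum_eq, splitSum_eq_of_right]
  · simp
  · exact fun P Q hQ => linkSum_nil_of_ne hQ _

theorem splitSum_append (S T : LTree D) (f : LTree D → LTree D → M) :
    splitSum (append S T) f = splitSum S fun A B => splitSum T fun P Q =>
      f (append A P) (append B Q) := by
  induction S generalizing f with
  | nil => simp
  | cons E C G _ ih => simp [splitSum_cons, ih]

theorem linkSum_append (S T U : LTree D) (f : LTree D → M) :
    linkSum S (append T U) f = splitSum S fun A B => linkSum A T fun T' => linkSum B U fun U' =>
      f (append T' U') := by
  induction T generalizing S f with
  | nil =>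
    rw [splitSum_eq_of_left]
    · simp
    · exact fun P Q hP => linkSum_nil_of_ne hP _
  | cons E C G _ ih =>
    simp only [cons_append, linkSum_cons, ih, graftSum_splitSum_comm, splitSum_assoc]

theorem linkSum_splitSum (S T : LTree D) (f : LTree D → LTree D → M) :
    linkSum S T (fun T' => splitSum T' f) = splitSum S fun A B => splitSum T fun P Q =>
      linkSum A P fun P' => linkSum B Q fun Q' => f P' Q' := by
  induction T generalizing S f with
  | nil =>
    cases S with
    | nil => simp
    | cons E C G => simp [splitSum_cons]
  | cons E C G _ ih =>
    simp only [linkSum_cons, splitSum_cons, linkSum_add, graftSum_add, splitSum_add, ih,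
      graftSum_splitSum_comm]
    congr 1
    · rw [← splitSum_assoc]
      congr! 3 with A B
      rw [splitSum_comm]
    · rw [splitSum_left_comm]
      congr! 3 with A B
      simp only [linkSum_splitSum_comm, graftSum_linkSum_comm]
      rw [splitSum_comm]

/-- This is `Δ(ST) = Δ(S)Δ(T)`. A branch of `S` linked to the root is a new root branch and chooses
its side freely; one linked lower down follows the root branch of `T` that carries it. Cutting after
grafting is thus cutting both trees and grafting side by side. -/
theorem graftSum_splitSum (S T : LTree D) (f : LTree D → LTree D → M) :
    graftSum S T (fun T' => splitSum T' f) = splitSum S fun A B => splitSum T fun P Q =>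
      graftSum A P fun P' => graftSum B Q fun Q' => f P' Q' := by
  simp only [graftSum_eq, splitSum_append, linkSum_splitSum_comm, linkSum_splitSum]
  rw [splitSum_interchange S fun A₁ A₂ B₁ B₂ => splitSum T fun P Q => linkSum B₁ P fun P' =>
    linkSum B₂ Q fun Q' => f (append A₁ P') (append A₂ Q')]
  congr! 3 with A B
  rw [splitSum_comm T]
  congr! 3 with A₁ A₂
  rw [splitSum_comm T]

/-! ### Associativity of grafting. -/

theorem graftSum_linkSum_nil (S T : LTree D) (f : LTree D → M) :
    graftSum S T (fun V => linkSum V nil f) = linkSum T nil fun W => linkSum S W f := by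
  cases T with
  | nil => simp
  | cons E C G =>
    simp only [linkSum_cons_nil, graftSum_eq]
    refine (splitSum_eq_of_left fun P Q hP => ?_).trans ?_
    · cases P with
      | nil => exact (hP rfl).elim
      | cons => simp
    · simp [linkSum_cons, graftSum_eq]

/-- Full associativity over `U` follows from its version for links to non-root nodes of `U`:
separate the branches that end at the root of `U`, and use that cutting is compatible with grafting.
-/
theorem graftSum_graftSum_of_linkSum {U : LTree D} (h : ∀ (S T : LTree D) (f : LTree D → M),
      graftSum S T (fun V => linkSum V U f) = linkSum T U fun W => linkSum S W f)
    (S T : LTree D) (f : LTree D → M) :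
    graftSum S T (fun V => graftSum V U f) = graftSum T U fun W => graftSum S W f := by
  have h₁ : graftSum S T (fun V => graftSum V U f) = splitSum S fun X Y => splitSum T fun A B =>
      graftSum X A fun P => linkSum B U fun U' => linkSum Y U' fun U'' => f (append P U'') := by
    simp only [graftSum_eq _ U, graftSum_splitSum, h]
  rw [h₁, graftSum_eq T U, splitSum_comm]
  congr! 3 with A B
  simp only [graftSum_eq, linkSum_append, linkSum_splitSum_comm, append_assoc, splitSum_assoc]
  simp only [linkSum_comm B U]

/-- Both statements are proved in one induction, since linking below the root of `cons E C G` means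
grafting onto `C`, root included, but linking only to non-root nodes of `G`. -/
theorem graftSum_linkSum_and_graftSum (U : LTree D) :
    (∀ (S T : LTree D) (f : LTree D → M),
      graftSum S T (fun V => linkSum V U f) = linkSum T U fun W => linkSum S W f) ∧
    ∀ (S T : LTree D) (f : LTree D → M),
      graftSum S T (fun V => graftSum V U f) = graftSum T U fun W => graftSum S W f := by
  induction U with
  | nil => exact ⟨graftSum_linkSum_nil, graftSum_graftSum_of_linkSum graftSum_linkSum_nil⟩
  | cons E C G ihC ihG =>
    have h : ∀ (S T : LTree D) (f : LTree D → M), graftSum S T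
        (fun V => linkSum V (cons E C G) f) = linkSum T (cons E C G) fun W => linkSum S W f := by
      intro S T f
      simp only [linkSum_cons, graftSum_splitSum]
      rw [splitSum_comm]
      congr! 3 with A B
      simp only [graftSum_splitSum_comm, linkSum_splitSum_comm]
      congr! 3 with X Y
      simp only [← graftSum_linkSum_comm, ← ihC.2, ← ihG.1]

      simp only [graftSum_comm Y B]
    exact ⟨h, graftSum_graftSum_of_linkSum h⟩

end LTree

/-! ## Trees with a marked node -/

/-- A tree with a distinguished non root node whose label and subtree are left open. -/
inductive TreeCtx (D : Type*) where
  | hole (G : LTree D) : TreeCtx D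
  | child (E : D) (c : TreeCtx D) (G : LTree D) : TreeCtx D
  | sibling (E : D) (C : LTree D) (c : TreeCtx D) : TreeCtx D

theorem LTree.splits_swap {D : Type*} (T : LTree D) : T.splits = T.splits.map Prod.swap := by
  -- Summing singletons recovers an identity of multisets from the identity of sums.
  have h := T.splitSum_swap fun P Q => ({(P, Q)} : Multiset (LTree D × LTree D))
  rw [← Multiset.bind_singleton]
  exact (Multiset.sum_map_singleton T.splits).symm.trans h

namespace TreeCtx

open LTree

variable {D M : Type*} [AddCommMonoid M]

/-- The tree obtained by giving the distinguished node the label `F` and the subtree `C`. -/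
def fill : TreeCtx D → D → LTree D → LTree D
  | hole G, F, C => cons F C G
  | child E c G, F, C => cons E (c.fill F C) G
  | sibling E C' c, F, C => cons E C' (c.fill F C)

/-- The number of children of the root. -/
def length : TreeCtx D → ℕ
  | hole G => G.length + 1
  | child _ _ G => G.length + 1
  | sibling _ _ c => c.length + 1

/-- Add the branches of a tree to the left of those of a context. -/
def prepend : LTree D → TreeCtx D → TreeCtx D
  | nil, c => c
  | cons E C G, c => sibling E C (prepend G c)

/-- Add the branches of a tree to the right of those of a context. -/
def append : TreeCtx D → LTree D → TreeCtx D
  | hole G, T => hole (G.append T)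
  | child E c G, T => child E c (G.append T)
  | sibling E C c, T => sibling E C (c.append T)

theorem fill_prepend (A : LTree D) (c : TreeCtx D) (F : D) (C : LTree D) :
    (c.prepend A).fill F C = A.append (c.fill F C) := by
  induction A with
  | nil => rfl
  | cons E C G _ ih => simp [prepend, fill, ih]

theorem fill_append (c : TreeCtx D) (T : LTree D) (F : D) (C : LTree D) :
    (c.append T).fill F C = (c.fill F C).append T := by
  induction c with
  | hole G => rfl
  | child E c G _ => rfl
  | sibling E C c ih => simp [append, fill, ih]

theorem fill_ne_nil (c : TreeCtx D) (F : D) (C : LTree D) : c.fill F C ≠ nil := by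
  cases c <;> simp [fill]

/-- With `exists_node`, this lets statements about nodes and replacements be exchanged for
statements about contexts and fillings. -/
theorem exists_fill_eq {T : LTree D} (i : T.Node) : ∃ c : TreeCtx D,
    T = c.fill i.label i.subtree ∧ ∀ F C, i.replace F C = c.fill F C := by
  induction i with
  | @here E C G => exact ⟨hole G, rfl, fun _ _ => rfl⟩
  | @child E C G i ih =>
    obtain ⟨c, h, h'⟩ := ih
    exact ⟨child E c G, congrArg (fun X => cons E X G) h, fun F X => congrArg (cons E · G) (h' F X)⟩
  | @sibling E C G i ih =>
    obtain ⟨c, h, h'⟩ := ih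
    exact ⟨sibling E C c, congrArg (fun X => cons E C X) h, fun F X => congrArg (cons E C) (h' F X)⟩

theorem exists_node (c : TreeCtx D) (F : D) (C : LTree D) : ∃ i : (c.fill F C).Node,
    i.label = F ∧ i.subtree = C ∧ ∀ F' C', i.replace F' C' = c.fill F' C' := by
  induction c with
  | hole G => exact ⟨.here, rfl, rfl, fun _ _ => rfl⟩
  | child E c G ih =>
    obtain ⟨i, h, h', h''⟩ := ih
    exact ⟨.child i, h, h', fun F' C' => congrArg (cons E · G) (h'' F' C')⟩
  | sibling E C' c ih =>
    obtain ⟨i, h, h', h''⟩ := ih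
    exact ⟨.sibling i, h, h', fun F' C'' => congrArg (cons E C') (h'' F' C'')⟩

/-- All the ways of choosing some branches of a context, the branch which contains the
distinguished node being chosen. -/
def splits : TreeCtx D → Multiset (TreeCtx D × LTree D)
  | hole G => (LTree.splits G).map fun p => (hole p.1, p.2)
  | child E c G => (LTree.splits G).map fun p => (child E c p.1, p.2)
  | sibling E C c => (splits c).map (fun p => (sibling E C p.1, p.2)) +
      (splits c).map fun p => (p.1, cons E C p.2)

/-- The sum of `f` over all pairs in `c.splits`. -/
def splitSum (c : TreeCtx D) (f : TreeCtx D → LTree D → M) : M :=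
  (c.splits.map fun p => f p.1 p.2).sum

@[simp] theorem splitSum_zero (c : TreeCtx D) : c.splitSum (fun _ _ => (0 : M)) = 0 :=
  Multiset.sum_map_zero

theorem splitSum_mem {S : Type*} [SetLike S M] [AddSubmonoidClass S M] {I : S} (c : TreeCtx D)
    {f : TreeCtx D → LTree D → M} (h : ∀ c' Q, f c' Q ∈ I) : c.splitSum f ∈ I := by
  refine multiset_sum_mem _ fun x hx => ?_
  obtain ⟨p, -, rfl⟩ := Multiset.mem_map.1 hx
  exact h _ _

theorem splitSum_add (c : TreeCtx D) (f g : TreeCtx D → LTree D → M) :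
    c.splitSum (fun P Q => f P Q + g P Q) = c.splitSum f + c.splitSum g :=
  Multiset.sum_map_add

theorem splitSum_sub {M : Type*} [AddCommGroup M] (c : TreeCtx D)
    (f g : TreeCtx D → LTree D → M) :
    c.splitSum (fun P Q => f P Q - g P Q) = c.splitSum f - c.splitSum g :=
  Multiset.sum_map_sub

theorem map_splitSum {N F : Type*} [AddCommMonoid N] [FunLike F M N] [AddMonoidHomClass F M N]
    (φ : F) (c : TreeCtx D) (f : TreeCtx D → LTree D → M) :
    φ (c.splitSum f) = c.splitSum fun P Q => φ (f P Q) := by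
  simp [splitSum, map_multiset_sum, Multiset.map_map]

theorem splitSum_comm (c : TreeCtx D) (T : LTree D)
    (f : TreeCtx D → LTree D → LTree D → LTree D → M) :
    c.splitSum (fun A B => T.splitSum fun P Q => f A B P Q) =
      T.splitSum fun P Q => c.splitSum fun A B => f A B P Q :=
  Multiset.sum_map_sum_map _ _

theorem splitSum_sibling (E : D) (C : LTree D) (c : TreeCtx D) (f : TreeCtx D → LTree D → M) :
    (sibling E C c).splitSum f =
      c.splitSum (fun P Q => f (sibling E C P) Q) + c.splitSum fun P Q => f P (cons E C Q) := by
  simp [splitSum, splits, Multiset.map_map]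

theorem splitSum_hole (G : LTree D) (f : TreeCtx D → LTree D → M) :
    (hole G).splitSum f = G.splitSum fun P Q => f (hole P) Q := by
  simp [splitSum, splits, Multiset.map_map, LTree.splitSum]

theorem splitSum_child (E : D) (c : TreeCtx D) (G : LTree D) (f : TreeCtx D → LTree D → M) :
    (child E c G).splitSum f = G.splitSum fun P Q => f (child E c P) Q := by
  simp [splitSum, splits, Multiset.map_map, LTree.splitSum]

theorem splitSum_assoc (c : TreeCtx D) (f : TreeCtx D → LTree D → LTree D → M) :
    c.splitSum (fun c' Q => c'.splitSum fun c'' P => f c'' P Q) =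
      c.splitSum fun c' Q => Q.splitSum fun A B => f c' A B := by
  induction c generalizing f with
  | hole G => simp only [splitSum_hole, LTree.splitSum_assoc]
  | child E c G _ => simp only [splitSum_child, LTree.splitSum_assoc]
  | sibling E C c ih =>
    simp only [splitSum_sibling, splitSum_add, ih, LTree.splitSum_cons, add_assoc]

/-- The branch with the marked node goes to exactly one of the two sides. Cocommutativity lets one
list of cuts of the context serve for both. -/
theorem splits_fill (c : TreeCtx D) (F : D) (C : LTree D) :
    (c.fill F C).splits =
      c.splits.map (fun p => (p.1.fill F C, p.2)) + c.splits.map fun p => (p.2, p.1.fill F C) := by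
  induction c with
  | hole G =>
    have h := congrArg (Multiset.map fun p => (p.1, cons F C p.2)) (splits_swap G)
    rw [Multiset.map_map] at h
    simp only [splits, fill, LTree.splits, Multiset.map_map, h]
    rfl
  | child E c G _ =>
    have h := congrArg (Multiset.map fun p => (p.1, cons E (c.fill F C) p.2)) (splits_swap G)
    rw [Multiset.map_map] at h
    simp only [splits, fill, LTree.splits, Multiset.map_map, h]
    rfl
  | sibling E C c ih =>
    simp only [splits, fill, LTree.splits, ih, Multiset.map_add, Multiset.map_map,
      Function.comp_def]
    abel

theorem splitSum_fill (c : TreeCtx D) (F : D) (C : LTree D) (f : LTree D → LTree D → M) :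
    (c.fill F C).splitSum f =
      c.splitSum fun c' Q => f (c'.fill F C) Q + f Q (c'.fill F C) := by
  simp [splitSum, LTree.splitSum, splits_fill, Multiset.map_map]

/-- It isolates the trivial cut, so that an identity summed over all cuts can be solved for its
leading term by induction on the number of root branches. -/
theorem exists_splits_eq_cons (c : TreeCtx D) :
    ∃ m : Multiset (TreeCtx D × LTree D), splits c = (c, nil) ::ₘ m ∧
      ∀ p ∈ m, p.1.length < c.length := by
  have hlen : ∀ c : TreeCtx D, ∀ p ∈ splits c, p.1.length ≤ c.length := by
    intro c
    induction c with
    | hole G =>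
      obtain ⟨m, hm, h⟩ := exists_splits_eq_cons_right G
      simp only [splits, Multiset.mem_map, hm, Multiset.mem_cons]
      rintro p ⟨q, rfl | hq, rfl⟩
      · simp
      · simpa [length] using (h q hq).2.le
    | child E c G =>
      obtain ⟨m, hm, h⟩ := exists_splits_eq_cons_right G
      simp only [splits, Multiset.mem_map, hm, Multiset.mem_cons]
      rintro p ⟨q, rfl | hq, rfl⟩
      · simp
      · simpa [length] using (h q hq).2.le
    | sibling E C c ih =>
      simp only [splits, Multiset.mem_add, Multiset.mem_map]
      rintro p (⟨q, hq, rfl⟩ | ⟨q, hq, rfl⟩)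
      · simpa [length] using ih q hq
      · exact (ih q hq).trans (by simp [length])
  induction c with
  | hole G =>
    obtain ⟨m, hm, h⟩ := exists_splits_eq_cons_right G
    refine ⟨m.map fun p => (hole p.1, p.2), by simp [splits, hm], ?_⟩
    simp only [Multiset.mem_map]
    rintro p ⟨q, hq, rfl⟩
    simpa [length] using (h q hq).2
  | child E c G =>
    obtain ⟨m, hm, h⟩ := exists_splits_eq_cons_right G
    refine ⟨m.map fun p => (child E c p.1, p.2), by simp [splits, hm], ?_⟩
    simp only [Multiset.mem_map]
    rintro p ⟨q, hq, rfl⟩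
    simpa [length] using (h q hq).2
  | sibling E C c ih =>
    obtain ⟨m, hm, h⟩ := ih
    refine ⟨m.map (fun p => (sibling E C p.1, p.2)) +
      (splits c).map (fun p => (p.1, cons E C p.2)), ?_, ?_⟩
    · conv_lhs => rw [splits]
      nth_rewrite 1 [hm]
      simp
    · simp only [Multiset.mem_add, Multiset.mem_map]
      rintro p (⟨q, hq, rfl⟩ | ⟨q, hq, rfl⟩)
      · simpa [length] using h q hq
      · simpa [length, Nat.lt_succ_iff] using hlen c q hq

/-! ### Linking branches to a tree with a marked node -/

/-- All the contexts obtained by linking the branches at the root of a tree to nodes of a context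
other than the root and outside the subtree of the distinguished node. -/
def link : LTree D → TreeCtx D → Multiset (TreeCtx D)
  | S, hole G => (linkBelow S G).map hole
  | S, child E c G =>
      (LTree.splits S).bind fun p => (LTree.splits p.1).bind fun q =>
        (link q.2 c).bind fun c' => (linkBelow p.2 G).map fun G' => child E (c'.prepend q.1) G'
  | S, sibling E C c =>
      (LTree.splits S).bind fun p => (graftings p.1 C).bind fun C' =>
        (link p.2 c).map fun c' => sibling E C' c'

/-- The sum of `f` over all contexts in `link S c`. -/
def linkSum (S : LTree D) (c : TreeCtx D) (f : TreeCtx D → M) : M := ((link S c).map f).sum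

theorem linkSum_hole (S G : LTree D) (f : TreeCtx D → M) :
    linkSum S (hole G) f = LTree.linkSum S G fun G' => f (hole G') := by
  simp [linkSum, link, LTree.linkSum, Multiset.map_map]

theorem linkSum_child (S G : LTree D) (E : D) (c : TreeCtx D) (f : TreeCtx D → M) :
    linkSum S (child E c G) f = S.splitSum fun P Q => P.splitSum fun A B => linkSum B c fun c' =>
      LTree.linkSum Q G fun G' => f (child E (c'.prepend A) G') := by
  simp [linkSum, link, LTree.linkSum, LTree.splitSum, Multiset.map_bind, Multiset.sum_bind]

theorem linkSum_sibling (S C : LTree D) (E : D) (c : TreeCtx D) (f : TreeCtx D → M) :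
    linkSum S (sibling E C c) f = S.splitSum fun P Q => graftSum P C fun C' =>
      linkSum Q c fun c' => f (sibling E C' c') := by
  simp [linkSum, link, LTree.splitSum, graftSum, Multiset.map_bind, Multiset.sum_bind]

/-- Branches linked to the marked node or below it form a grafting onto `C`; the others change only
the context. The two choices are independent. -/
theorem linkSum_fill (S : LTree D) (c : TreeCtx D) (F : D) (C : LTree D) (f : LTree D → M) :
    LTree.linkSum S (c.fill F C) f = S.splitSum fun P Q => graftSum P C fun C' =>
      linkSum Q c fun c' => f (c'.fill F C') := by
  induction c generalizing S f with
  | hole G => simp only [fill, linkSum_hole, linkSum_cons]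
  | child E c G ih =>
    simp only [fill, linkSum_child, linkSum_cons, graftSum_eq _ (c.fill F C), ih,
      graftSum_splitSum_comm, fill_prepend]
    simp only [LTree.splitSum_assoc]
    rw [splitSum_left_comm]
  | sibling E C' c ih =>
    simp only [fill, linkSum_sibling, linkSum_cons, ih, graftSum_splitSum_comm]
    rw [splitSum_left_comm]
    simp only [LTree.graftSum_comm _ C]

/-- All the contexts obtained by linking the branches at the root of a tree to nodes of a context
outside the subtree of the distinguished node. -/
def graftings (S : LTree D) (c : TreeCtx D) : Multiset (TreeCtx D) :=
  (LTree.splits S).bind fun p => (link p.2 c).map fun c' => c'.prepend p.1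

/-- The sum of `f` over all contexts in `graftings S c`. -/
def graftSum (S : LTree D) (c : TreeCtx D) (f : TreeCtx D → M) : M := ((graftings S c).map f).sum

theorem graftSum_fill (S : LTree D) (c : TreeCtx D) (F : D) (C : LTree D) (f : LTree D → M) :
    LTree.graftSum S (c.fill F C) f = S.splitSum fun P Q => LTree.graftSum P C fun C' =>
      graftSum Q c fun c' => f (c'.fill F C') := by
  have h : ∀ (S : LTree D) (g : TreeCtx D → M), graftSum S c g =
      S.splitSum fun A B => linkSum B c fun c' => g (c'.prepend A) := by
    intro S g
    simp [graftSum, graftings, LTree.splitSum, linkSum, Multiset.map_bind, Multiset.sum_bind]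
  simp only [graftSum_eq _ (c.fill F C), linkSum_fill, h, graftSum_splitSum_comm, fill_prepend]
  rw [splitSum_left_comm]

theorem graftSum_mem {A : Type*} [SetLike A M] [AddSubmonoidClass A M] {I : A} (S : LTree D)
    (c : TreeCtx D) {f : TreeCtx D → M} (h : ∀ c, f c ∈ I) : graftSum S c f ∈ I := by
  refine multiset_sum_mem _ fun x hx => ?_
  obtain ⟨p, -, rfl⟩ := Multiset.mem_map.1 hx
  exact h _

theorem graftSum_sub {M : Type*} [AddCommGroup M] (S : LTree D) (c : TreeCtx D)
    (f g : TreeCtx D → M) :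
    graftSum S c (fun U => f U - g U) = graftSum S c f - graftSum S c g :=
  Multiset.sum_map_sub

theorem map_graftSum {N F : Type*} [AddCommMonoid N] [FunLike F M N] [AddMonoidHomClass F M N]
    (φ : F) (S : LTree D) (c : TreeCtx D) (f : TreeCtx D → M) :
    φ (graftSum S c f) = graftSum S c fun c' => φ (f c') := by
  simp [graftSum, map_multiset_sum, Multiset.map_map]

theorem graftSum_splitSum_comm (S T : LTree D) (c : TreeCtx D)
    (f : TreeCtx D → LTree D → LTree D → M) :
    graftSum S c (fun A => T.splitSum fun P Q => f A P Q) =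
      T.splitSum fun P Q => graftSum S c fun A => f A P Q :=
  Multiset.sum_map_sum_map _ _

theorem graftSum_graftSum_comm (S T U : LTree D) (c : TreeCtx D) (f : LTree D → TreeCtx D → M) :
    LTree.graftSum T U (fun A => graftSum S c fun P => f A P) =
      graftSum S c fun P => LTree.graftSum T U fun A => f A P :=
  Multiset.sum_map_sum_map _ _

/-! ### Linking the branches of a tree with a marked node -/

/-- A family of multisets of trees which is given by a multiset of contexts. -/
def IsContextual (s : D → LTree D → Multiset (LTree D)) : Prop :=
  ∃ m : Multiset (TreeCtx D), ∀ F C, s F C = m.map fun c => c.fill F C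

namespace IsContextual

theorem add {s t : D → LTree D → Multiset (LTree D)} (hs : IsContextual s) (ht : IsContextual t) :
    IsContextual fun F C => s F C + t F C := by
  obtain ⟨m, hm⟩ := hs
  obtain ⟨n, hn⟩ := ht
  exact ⟨m + n, fun F C => by simp only [hm, hn, Multiset.map_add]⟩

theorem bind {α : Type*} (u : Multiset α) {s : α → D → LTree D → Multiset (LTree D)}
    (hs : ∀ a, IsContextual (s a)) : IsContextual fun F C => u.bind fun a => s a F C := by
  choose m hm using hs
  exact ⟨u.bind m, fun F C => by simp only [hm, Multiset.map_bind]⟩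

theorem map {s : D → LTree D → Multiset (LTree D)} (hs : IsContextual s) {g : LTree D → LTree D}
    {h : TreeCtx D → TreeCtx D} (hg : ∀ c F C, g (c.fill F C) = (h c).fill F C) :
    IsContextual fun F C => (s F C).map g := by
  obtain ⟨m, hm⟩ := hs
  exact ⟨m.map h, fun F C => by simp [hm, Multiset.map_map, hg]⟩

end IsContextual

/-- Either the root branch with the marked node is linked to the root of `V` and stays a root
branch, or it is linked lower down, where the hypothesis applies. In both cases its interior is
untouched. -/
theorem isContextual_graftings_of_linkBelow {V : LTree D}
    (h : ∀ c : TreeCtx D, IsContextual fun F C => linkBelow (c.fill F C) V) (c : TreeCtx D) :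
    IsContextual fun F C => LTree.graftings (c.fill F C) V := by
  have : (fun F C => LTree.graftings (c.fill F C) V) = fun F C =>
      (c.splits.bind fun p => (linkBelow p.2 V).map fun T => (p.1.append T).fill F C) +
      (c.splits.bind fun p => (linkBelow (p.1.fill F C) V).map fun T => LTree.append p.2 T) := by
    funext F C
    simp [LTree.graftings, splits_fill, Multiset.add_bind, Multiset.bind_map, fill_append]
  rw [this]
  refine .add (.bind _ fun p => ⟨(linkBelow p.2 V).map fun T => p.1.append T, fun F C => ?_⟩)
    (.bind _ fun p => (h p.1).map (h := TreeCtx.prepend p.2) fun c F C => ?_)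
  · simp [Multiset.map_map]
  · rw [fill_prepend]

theorem isContextual_linkBelow (c : TreeCtx D) (V : LTree D) :
    IsContextual fun F C => linkBelow (c.fill F C) V := by
  induction V generalizing c with
  | nil =>
    -- A filled context has a root branch, and the one-node tree offers no non-root node to link it
    -- to.
    refine ⟨0, fun F C => ?_⟩
    cases c <;> simp [fill, linkBelow]
  | cons E C' G ihC ihG =>
    have : (fun F C => linkBelow (c.fill F C) (cons E C' G)) = fun F C =>
        (c.splits.bind fun p => (linkBelow p.2 G).bind fun G' =>
          (LTree.graftings (p.1.fill F C) C').map fun X => cons E X G') +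
        (c.splits.bind fun p => (LTree.graftings p.2 C').bind fun X =>
          (linkBelow (p.1.fill F C) G).map fun G' => cons E X G') := by
      funext F C
      have h := LTree.linkSum_cons (c.fill F C) E C' G fun U => ({U} : Multiset (LTree D))
      rw [splitSum_fill, splitSum_add] at h
      simp [LTree.linkSum, LTree.graftSum, splitSum] at h
      simp only [← Multiset.bind_singleton]
      rw [h]
      congr 1
      exact Multiset.bind_congr fun p _ => Multiset.bind_bind _ _
    rw [this]
    refine .add (.bind _ fun p => .bind _ fun G' => ?_) (.bind _ fun p => .bind _ fun X => ?_)
    · exact (isContextual_graftings_of_linkBelow ihC p.1).map (h := fun c => child E c G')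
        fun _ _ _ => rfl
    · exact (ihG p.1).map (h := fun c => sibling E X c) fun _ _ _ => rfl

theorem isContextual_graftings (c : TreeCtx D) (V : LTree D) :
    IsContextual fun F C => LTree.graftings (c.fill F C) V :=
  isContextual_graftings_of_linkBelow (fun c => isContextual_linkBelow c V) c

end TreeCtx

open LTree

/-! ## The algebra of trees -/

namespace KLT

variable {k D : Type*} [Field k]

theorem hom_ext {M : Type*} [AddCommMonoid M] [Module k M] {f g : KLT k D →ₗ[k] M}
    (h : ∀ T, f (tree k T) = g (tree k T)) : f = g :=
  Finsupp.lhom_ext' fun T => LinearMap.ext_ring (h T)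

theorem apply_mem {M : Type*} [AddCommGroup M] [Module k M] (f : KLT k D →ₗ[k] M)
    {p : Submodule k M} (h : ∀ T, f (tree k T) ∈ p) (g : KLT k D) : f g ∈ p := by
  have : p.mkQ ∘ₗ f = 0 := hom_ext fun T => by simpa using h T
  simpa using LinearMap.congr_fun this g

theorem one_def : (1 : KLT k D) = tree k nil := rfl

theorem mul_def (g h : KLT k D) : g * h = mulMap g h := rfl

theorem tree_mul_tree (S T : LTree D) : tree k S * tree k T = graftSum S T (tree k) := by
  simp [mul_def, mulMap, graftSum]

theorem comul_tree (T : LTree D) :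
    comul (tree k T) = T.splitSum fun P Q => tree k P ⊗ₜ[k] tree k Q := by
  simp [comul, splitSum]

@[simp] theorem counit_nil : counit (tree k (nil : LTree D)) = 1 := by
  simp [counit]

theorem counit_of_ne {T : LTree D} (h : T ≠ nil) : counit (tree k T) = 0 := by
  cases T with
  | nil => exact (h rfl).elim
  | cons E C G => simp [counit]

theorem splitSum_counit_smul {M : Type*} [AddCommMonoid M] [Module k M] (T : LTree D)
    (f : LTree D → M) : (T.splitSum fun P Q => counit (tree k P) • f Q) = f T := by
  rw [splitSum_eq_of_left]
  · simp
  · intro P Q hP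
    rw [counit_of_ne hP, zero_smul]

theorem tree_nil_mul (g : KLT k D) : tree k nil * g = g := by
  have : mulMap (tree k nil) = (LinearMap.id : KLT k D →ₗ[k] KLT k D) :=
    hom_ext fun T => by rw [← mul_def, tree_mul_tree, graftSum_nil]; rfl
  exact LinearMap.congr_fun this g

theorem mul_tree_nil (g : KLT k D) : g * tree k nil = g := by
  have : mulMap.flip (tree k nil) = (LinearMap.id : KLT k D →ₗ[k] KLT k D) :=
    hom_ext fun T => by
      rw [LinearMap.flip_apply, ← mul_def, tree_mul_tree, graftSum_nil_right]; rfl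
  exact LinearMap.congr_fun this g

theorem splitSum_mul (T : LTree D) (f : LTree D → LTree D → KLT k D) (g : KLT k D) :
    T.splitSum f * g = T.splitSum fun P Q => f P Q * g :=
  map_splitSum (mulMap.flip g) T f

theorem mul_splitSum (T : LTree D) (f : LTree D → LTree D → KLT k D) (g : KLT k D) :
    g * T.splitSum f = T.splitSum fun P Q => g * f P Q :=
  map_splitSum (mulMap g) T f

theorem assoc (f g h : KLT k D) : f * g * h = f * (g * h) := by
  have h₁ (S T : LTree D) (h : KLT k D) : tree k S * tree k T * h = tree k S * (tree k T * h) := by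
    refine LinearMap.congr_fun (f := mulMap (tree k S * tree k T))
      (g := mulMap (tree k S) ∘ₗ mulMap (tree k T)) (hom_ext fun U => ?_) h
    change tree k S * tree k T * tree k U = tree k S * (tree k T * tree k U)
    rw [tree_mul_tree, tree_mul_tree]
    refine (map_graftSum (mulMap.flip (tree k U)) S T _).trans
      (Eq.trans ?_ (map_graftSum (mulMap (tree k S)) T U _).symm)
    refine Eq.trans ?_ (((graftSum_linkSum_and_graftSum U).2 S T (tree k)).trans ?_)
    · exact congrArg _ (funext fun V => tree_mul_tree V U)
    · exact congrArg _ (funext fun V => (tree_mul_tree S V).symm)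
  have h₂ (S : LTree D) (g h : KLT k D) : tree k S * g * h = tree k S * (g * h) :=
    LinearMap.congr_fun (f := mulMap.flip h ∘ₗ mulMap (tree k S))
      (g := mulMap (tree k S) ∘ₗ mulMap.flip h) (hom_ext fun T => h₁ S T h) g
  exact LinearMap.congr_fun (f := mulMap.flip h ∘ₗ mulMap.flip g)
    (g := mulMap.flip (g * h)) (hom_ext fun S => h₂ S g h) f

/-! ### The antipode as a two-sided convolution inverse of the identity. -/

@[simp] theorem antipode_tree (T : LTree D) : antipode (tree k T) = antipodeTree T :=
  extend_tree _ _

@[simp] theorem antipodeTree_nil : antipodeTree (nil : LTree D) = (tree k nil : KLT k D) := by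
  rw [antipodeTree]; rfl

theorem antipode_mul (T : LTree D) :
    (T.splitSum fun P Q => antipodeTree P * tree k Q) = counit (tree k T) • tree k nil := by
  cases T with
  | nil => simp [mul_tree_nil]
  | cons E C G =>
    obtain ⟨m, hm, h⟩ := exists_splits_eq_cons_right (cons E C G)
    rw [counit_of_ne (by simp), zero_smul, splitSum, hm]
    -- The filter in the recursion removes exactly the leading pair `(T, 1)`, so the recursion
    -- cancels the remaining terms.
    rw [Multiset.map_cons, Multiset.sum_cons, mul_tree_nil, antipodeTree,
      Multiset.attach_map_val' _ fun p : LTree D × LTree D => antipodeTree p.1 * tree k p.2, hm,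
      Multiset.filter_cons_of_neg _ (by simp), Multiset.filter_eq_self.2 fun p hp => (h p hp).2,
      neg_add_cancel]

/-- Let `V` be the error in this identity. The left inverse property gives `S * V = (S * id) * S - S
= 0` for convolution. The leading term of this sum is `V T`, and the others contain `V` of trees
with fewer root branches, zero by induction. -/
theorem mul_antipode (T : LTree D) :
    (T.splitSum fun P Q => tree k P * antipodeTree Q) = counit (tree k T) • tree k nil := by
  induction hn : T.length using Nat.strong_induction_on generalizing T with
  | _ n ih =>
    subst hn
    set V : LTree D → KLT k D := fun T =>
      (T.splitSum fun P Q => tree k P * antipodeTree Q) - counit (tree k T) • tree k nil with hV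
    have h₁ : (T.splitSum fun P Q => antipodeTree Q * V P) = 0 := by
      have h₂ : ∀ P Q, antipodeTree Q * V P =
          (P.splitSum fun A B => antipodeTree Q * tree k A * antipodeTree B) -
            counit (tree k P) • antipodeTree Q := by
        intro P Q
        refine (map_sub (mulMap (antipodeTree Q)) _ _).trans (congrArg₂ _ ?_ ?_)
        · simp only [← mul_def, mul_splitSum, assoc]
        · rw [map_smul, ← mul_def, mul_tree_nil]
      simp only [h₂]
      rw [LTree.splitSum_sub, splitSum_counit_smul, LTree.splitSum_swap, ← LTree.splitSum_assoc]
      have h₃ : ∀ P Q : LTree D, (P.splitSum fun A B => antipodeTree A * tree k B * antipodeTree Q) =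
          counit (tree k P) • antipodeTree Q := by
        intro P Q
        rw [← splitSum_mul, antipode_mul, mul_def, map_smul, LinearMap.smul_apply, ← mul_def,
          tree_nil_mul]
      simp only [h₃]
      rw [splitSum_counit_smul, sub_self]
    obtain ⟨m, hm, h⟩ := exists_splits_eq_cons_right T
    rw [splitSum, hm, Multiset.map_cons, Multiset.sum_cons, Multiset.sum_eq_zero, add_zero,
      antipodeTree_nil, tree_nil_mul] at h₁
    · exact sub_eq_zero.1 h₁
    · simp only [Multiset.mem_map]
      rintro x ⟨p, hp, rfl⟩
      have : V p.1 = 0 := sub_eq_zero.2 (ih _ (h p hp).2 _ rfl)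
      rw [this]
      exact map_zero (mulMap (antipodeTree p.2))

end KLT

/-! ## Actions and the smash product -/

section Act

variable {k R D : Type*} [Field k] [CommRing R] [Algebra k R] {ρ : KLT k D →ₗ[k] R →ₗ[k] R}

theorem smul_splitSum {M : Type*} [AddCommMonoid M] [Module R M] (r : R) (T : LTree D)
    (f : LTree D → LTree D → M) : r • T.splitSum f = T.splitSum fun P Q => r • f P Q :=
  map_splitSum (DistribSMul.toAddMonoidHom M r) T f

theorem smul_graftSum {M : Type*} [AddCommMonoid M] [Module R M] (r : R) (S T : LTree D)
    (f : LTree D → M) : r • graftSum S T f = graftSum S T fun U => r • f U :=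
  map_graftSum (DistribSMul.toAddMonoidHom M r) S T f

theorem graftSum_smul {M : Type*} [AddCommMonoid M] [Module R M] (x : M) (S T : LTree D)
    (f : LTree D → R) : graftSum S T f • x = graftSum S T fun U => f U • x :=
  map_graftSum ((smulAddHom R M).flip x) S T f

theorem act_mul_act (hρ : IsModuleAlgebra ρ) (S T : LTree D) (r : R) :
    ρ (KLT.tree k S) (ρ (KLT.tree k T) r) = graftSum S T fun U => ρ (KLT.tree k U) r := by
  rw [← hρ.mul_act, KLT.tree_mul_tree]
  exact map_graftSum (ρ.flip r) S T _

theorem act_tree_mul (hρ : IsModuleAlgebra ρ) (T : LTree D) (r s : R) :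
    ρ (KLT.tree k T) (r * s) =
      T.splitSum fun P Q => ρ (KLT.tree k P) r * ρ (KLT.tree k Q) s := by
  simp [hρ.act_mul, KLT.comul_tree, map_splitSum]

/-- Let `a` be the error `T · 1 - ε(T)`. Expanding with `1 * 1 = 1` gives `∑ a(T_(1)) a(T_(2)) = -
a(T)`. On the left the trivial cut contributes zero because `a` vanishes at the one-node tree, and
the other cuts vanish by induction. -/
theorem act_tree_one (hρ : IsModuleAlgebra ρ) (T : LTree D) :
    ρ (KLT.tree k T) 1 = KLT.counit (KLT.tree k T) • (1 : R) := by
  induction hn : T.length using Nat.strong_induction_on generalizing T with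
  | _ n ih =>
    subst hn
    set a : LTree D → R := fun T => ρ (KLT.tree k T) 1 - KLT.counit (KLT.tree k T) • 1 with ha
    have ha_nil : a nil = 0 := by
      have := hρ.one_act 1
      rw [KLT.one_def] at this
      simp [ha, this]
    have h₁ : (T.splitSum fun P Q => a P * a Q) = - a T := by
      have h₂ : ∀ P Q, a P * a Q = (ρ (KLT.tree k P) 1 * ρ (KLT.tree k Q) 1 -
          KLT.counit (KLT.tree k P) • ρ (KLT.tree k Q) 1) -
          KLT.counit (KLT.tree k Q) • a P := by
        intro P Q
        simp only [ha, Algebra.smul_def]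
        ring
      simp only [h₂]
      rw [LTree.splitSum_sub, LTree.splitSum_sub, ← act_tree_mul hρ, KLT.splitSum_counit_smul,
        LTree.splitSum_swap, KLT.splitSum_counit_smul]
      simp
    obtain ⟨m, hm, h⟩ := exists_splits_eq_cons_right T
    rw [splitSum, hm, Multiset.map_cons, Multiset.sum_cons, Multiset.sum_eq_zero, ha_nil, mul_zero,
      add_zero, eq_comm, neg_eq_zero] at h₁
    · exact sub_eq_zero.1 h₁
    · simp only [Multiset.mem_map]
      rintro x ⟨p, hp, rfl⟩
      have : a p.1 = 0 := sub_eq_zero.2 (ih _ (h p hp).2 _ rfl)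
      rw [this, zero_mul]

theorem tree_tmul_eq (r : R) (g : KLT k D) : r ⊗ₜ[k] g = r • ((1 : R) ⊗ₜ[k] g) := by
  rw [TensorProduct.smul_tmul', smul_eq_mul, mul_one]

theorem smashMul_tmul (r : R) (h : KLT k D) (x : Smash k R D) :
    smashMul ρ (r ⊗ₜ h) x = r • hopfMul ρ h x := rfl

theorem hopfMul_tmul (U : LTree D) (s : R) (g : KLT k D) : hopfMul ρ (KLT.tree k U) (s ⊗ₜ g) =
    U.splitSum fun A B => ρ (KLT.tree k A) s ⊗ₜ (KLT.tree k B * g) := by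
  rw [hopfMul, LinearMap.comp_apply, KLT.comul_tree, LTree.map_splitSum]
  exact map_splitSum (LinearMap.applyₗ (s ⊗ₜ[k] g)) U _

theorem hopfMul_smul (hρ : IsModuleAlgebra ρ) (U : LTree D) (s : R) (x : Smash k R D) :
    hopfMul ρ (KLT.tree k U) (s • x) =
      U.splitSum fun A B => ρ (KLT.tree k A) s • hopfMul ρ (KLT.tree k B) x := by
  induction x using TensorProduct.induction_on with
  | zero => simp
  | add x y hx hy => simp only [smul_add, map_add, hx, hy, LTree.splitSum_add]
  | tmul t g =>
    rw [TensorProduct.smul_tmul', hopfMul_tmul]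
    simp only [hopfMul_tmul, smul_splitSum, TensorProduct.smul_tmul', smul_eq_mul,
      act_tree_mul hρ]
    rw [← LTree.splitSum_assoc]
    refine congrArg _ (funext₂ fun A B => ?_)
    exact map_splitSum ((TensorProduct.mk k R (KLT k D)).flip (KLT.tree k B * g)) A _

theorem hopfMul_one_tmul (hρ : IsModuleAlgebra ρ) (U : LTree D) (g : KLT k D) :
    hopfMul ρ (KLT.tree k U) (1 ⊗ₜ g) = 1 ⊗ₜ (KLT.tree k U * g) := by
  rw [hopfMul_tmul]
  simp only [act_tree_one hρ, ← TensorProduct.smul_tmul']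
  exact KLT.splitSum_counit_smul U fun B => (1 : R) ⊗ₜ[k] (KLT.tree k B * g)

/-- Left `R`-linearity of the product, for a fixed right factor. -/
theorem smashMul_smul (r : R) (x b : Smash k R D) :
    smashMul ρ (r • x) b = r • smashMul ρ x b := by
  induction x using TensorProduct.induction_on with
  | zero => simp
  | add x y hx hy => simp only [smul_add, map_add, LinearMap.add_apply, hx, hy]
  | tmul t g => rw [TensorProduct.smul_tmul', smashMul_tmul, smashMul_tmul, smul_eq_mul, mul_smul]

/-- Right multiplication by `b`, as an `R`-linear map. -/
noncomputable def smashMulRight (ρ : KLT k D →ₗ[k] R →ₗ[k] R) (b : Smash k R D) :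
    Smash k R D →ₗ[R] Smash k R D where
  toFun x := smashMul ρ x b
  map_add' x y := by simp
  map_smul' r x := smashMul_smul r x b

end Act

/-! ## The defect in the Leibnitz rule -/

section Defect

variable {k R D : Type*} [Field k] [CommRing R] [Algebra k R] {ρ : KLT k D →ₗ[k] R →ₗ[k] R}
  [SMul R D] {M N : Type*} [AddCommGroup M] [Module R M] [AddCommGroup N] [Module R N]

/-- The defect in the Leibnitz rule of a function `φ` on trees. -/
noncomputable def defect (ρ : KLT k D →ₗ[k] R →ₗ[k] R) (φ : LTree D → M) (c : TreeCtx D)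
    (C : LTree D) (r : R) (E : D) : M :=
  φ (c.fill (r • E) C) - C.splitSum fun P Q => ρ (KLT.tree k P) r • φ (c.fill E Q)

theorem defect_map (L : M →ₗ[R] N) (φ : LTree D → M) (c : TreeCtx D) (C : LTree D) (r : R) (E : D) :
    defect ρ (fun T => L (φ T)) c C r E = L (defect ρ φ c C r E) := by
  simp only [defect, map_sub, map_splitSum, map_smul]

theorem defect_add (φ ψ : LTree D → M) (c : TreeCtx D) (C : LTree D) (r : R) (E : D) :
    defect ρ (fun T => φ T + ψ T) c C r E = defect ρ φ c C r E + defect ρ ψ c C r E := by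
  simp only [defect, smul_add, LTree.splitSum_add]
  abel

/-- The marked node lies on one side of each cut, and the other side is a constant for the Leibnitz
expansion. -/
theorem defect_splitSum (ψ : LTree D → LTree D → M) (c : TreeCtx D) (C : LTree D) (r : R) (E : D) :
    defect ρ (fun T => T.splitSum ψ) c C r E = c.splitSum fun c' Q =>
      defect ρ (fun T => ψ T Q) c' C r E + defect ρ (fun T => ψ Q T) c' C r E := by
  have h : ∀ x : R, ∀ f : TreeCtx D → LTree D → M,
      x • c.splitSum f = c.splitSum fun P Q => x • f P Q :=
    fun x f => TreeCtx.map_splitSum (DistribSMul.toAddMonoidHom M x) c f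
  simp only [← defect_add]
  simp only [defect, TreeCtx.splitSum_fill, TreeCtx.splitSum_sub, TreeCtx.splitSum_comm, h]

/-- Branches of `U` grafted onto the marked subtree are shared between its two parts when that
subtree is cut. Those joining the part that acts on `r` compose with it as operators, and the rest
are grafted onto the remaining tree. -/
theorem splitSum_defect (hρ : IsModuleAlgebra ρ) (φ : LTree D → M) (U : LTree D) (c : TreeCtx D)
    (C : LTree D) (r : R) (E : D) :
    (U.splitSum fun P Q => graftSum P C fun C' => TreeCtx.graftSum Q c fun c' =>
        defect ρ φ c' C' r E) =
      graftSum U (c.fill (r • E) C) φ - C.splitSum fun P Q => U.splitSum fun A B =>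
        ρ (KLT.tree k A) (ρ (KLT.tree k P) r) • graftSum B (c.fill E Q) φ := by
  have hc : ∀ (x : R) (S : LTree D) (f : TreeCtx D → M),
      x • TreeCtx.graftSum S c f = TreeCtx.graftSum S c fun P => x • f P :=
    fun x S f => TreeCtx.map_graftSum (DistribSMul.toAddMonoidHom _ x) S c f
  simp only [defect, TreeCtx.graftSum_fill, TreeCtx.graftSum_sub,
    LTree.graftSum_sub, LTree.splitSum_sub, act_mul_act hρ, graftSum_smul,
    smul_splitSum, smul_graftSum, hc, TreeCtx.graftSum_splitSum_comm, LTree.graftSum_splitSum]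
  congr 1
  rw [LTree.splitSum_comm C, LTree.splitSum_assoc]
  refine congrArg _ (funext₂ fun P Q => ?_)
  rw [LTree.splitSum_comm C]
  refine congrArg _ (funext₂ fun A B => congrArg _ (funext₂ fun X Y => ?_))
  simp only [LTree.graftSum_comm P, TreeCtx.graftSum_graftSum_comm]

theorem defect_graftSum_mem {I : Submodule R M} {φ : LTree D → M}
    (h : ∀ c C r E, defect ρ φ c C r E ∈ I) (V : LTree D) (c : TreeCtx D) (C : LTree D) (r : R)
    (E : D) : defect ρ (fun T => graftSum T V φ) c C r E ∈ I := by
  obtain ⟨m, hm⟩ := c.isContextual_graftings V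
  have : defect ρ (fun T => graftSum T V φ) c C r E =
      (m.map fun c' => defect ρ φ c' C r E).sum := by
    have hs : ∀ F C, graftSum (c.fill F C) V φ = (m.map fun c' => φ (c'.fill F C)).sum := by
      intro F C
      have := hm F C
      simp only at this
      rw [graftSum, this, Multiset.map_map]
      rfl
    simp only [defect, hs, Multiset.sum_map_sub, Multiset.smul_sum, Multiset.map_map, splitSum]
    congr 1
    exact Multiset.sum_map_sum_map _ _
  rw [this]
  refine multiset_sum_mem _ fun x hx => ?_
  obtain ⟨c', -, rfl⟩ := Multiset.mem_map.1 hx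
  exact h _ _ _ _

end Defect

/-! ### The Leibnitz ideal: products, counit and coproduct. -/

section Ideal

variable {k R : Type*} [Field k] [CommRing R] [Algebra k R]
  {ρ : KLT k (Derivation k R R) →ₗ[k] R →ₗ[k] R}

theorem defect_mem_leibnitzIdeal (c : TreeCtx (Derivation k R R)) (C : LTree (Derivation k R R))
    (r : R) (E : Derivation k R R) :
    defect ρ (fun T => (1 : R) ⊗ₜ[k] KLT.tree k T) c C r E ∈ leibnitzIdeal ρ := by
  obtain ⟨i, h, h', h''⟩ := c.exists_node (r • E) C
  refine Submodule.subset_span ⟨c.fill (r • E) C, i, r, E, h, ?_⟩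
  simp only [h', h'', tree_tmul_eq (ρ _ _)]
  rfl

theorem leibnitzIdeal_le {N : Submodule R (Smash k R (Derivation k R R))}
    (h : ∀ c C r E, defect ρ (fun T => (1 : R) ⊗ₜ[k] KLT.tree k T) c C r E ∈ N) :
    leibnitzIdeal ρ ≤ N := by
  refine Submodule.span_le.2 ?_
  rintro _ ⟨T, i, r, E, hi, rfl⟩
  obtain ⟨c, hc, hc'⟩ := TreeCtx.exists_fill_eq i
  have := h c i.subtree r E
  rw [defect, ← hi, ← hc] at this
  simp only [← hc', ← tree_tmul_eq] at this
  exact this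

theorem hopfMul_defect (hρ : IsModuleAlgebra ρ) (U : LTree (Derivation k R R))
    (c : TreeCtx (Derivation k R R)) (C : LTree (Derivation k R R))
    (r : R) (E : Derivation k R R) :
    hopfMul ρ (KLT.tree k U) (defect ρ (fun T => (1 : R) ⊗ₜ[k] KLT.tree k T) c C r E) =
      U.splitSum fun P Q => graftSum P C fun C' => TreeCtx.graftSum Q c fun c' =>
        defect ρ (fun T => (1 : R) ⊗ₜ[k] KLT.tree k T) c' C' r E := by
  have h : ∀ (B T : LTree (Derivation k R R)),
      hopfMul ρ (KLT.tree k B) ((1 : R) ⊗ₜ[k] KLT.tree k T) =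
        graftSum B T fun U => (1 : R) ⊗ₜ[k] KLT.tree k U := by
    intro B T
    rw [hopfMul_one_tmul hρ, KLT.tree_mul_tree]
    exact map_graftSum (TensorProduct.mk k R _ 1) B T _
  rw [splitSum_defect hρ, defect, map_sub, h, map_splitSum]
  simp only [hopfMul_smul hρ, h]

theorem hopfMul_mem (hρ : IsModuleAlgebra ρ) (h : KLT k (Derivation k R R))
    {x : Smash k R (Derivation k R R)} (hx : x ∈ leibnitzIdeal ρ) :
    hopfMul ρ h x ∈ leibnitzIdeal ρ := by
  refine KLT.apply_mem ((hopfMul ρ).flip x) (p := (leibnitzIdeal ρ).restrictScalars k)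
    (fun U => ?_) h
  -- Left multiplication by a single `1 # U` is not `R`-linear; asking for all `U` at once gives an
  -- `R`-submodule, because a scalar only replaces `U` by its parts.
  let N : Submodule R (Smash k R (Derivation k R R)) :=
    { carrier := {x | ∀ U, hopfMul ρ (KLT.tree k U) x ∈ leibnitzIdeal ρ}
      zero_mem' := fun U => by simp
      add_mem' := fun hx hy U => by simpa using add_mem (hx U) (hy U)
      smul_mem' := fun r x hx U => by
        rw [hopfMul_smul hρ]
        exact U.splitSum_mem fun P Q => Submodule.smul_mem _ _ (hx Q) }
  suffices h : leibnitzIdeal ρ ≤ N from h hx U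
  refine leibnitzIdeal_le fun c C r E U => ?_
  rw [hopfMul_defect hρ]
  refine U.splitSum_mem fun P Q => graftSum_mem P C fun C' => ?_
  exact TreeCtx.graftSum_mem Q c fun c' => defect_mem_leibnitzIdeal c' C' r E

theorem smashMul_mem_left (hρ : IsModuleAlgebra ρ) (b x : Smash k R (Derivation k R R))
    (hx : x ∈ leibnitzIdeal ρ) : smashMul ρ b x ∈ leibnitzIdeal ρ := by
  induction b using TensorProduct.induction_on with
  | zero => simp
  | add b c hb hc => simpa using add_mem hb hc
  | tmul r h => exact Submodule.smul_mem _ r (hopfMul_mem hρ h hx)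

theorem defect_act_eq_zero (hρ : IsLeibnitz ρ) (s : R) (c : TreeCtx (Derivation k R R))
    (C : LTree (Derivation k R R)) (r : R) (E : Derivation k R R) :
    defect ρ (fun T => ρ (KLT.tree k T) s) c C r E = 0 := by
  obtain ⟨i, h, h', h''⟩ := c.exists_node (r • E) C
  have := hρ.leibnitz _ i r E h s
  simp only [h', h''] at this
  rw [defect, this]
  exact sub_self _

/-- In `(1 # T)(s # V) = ∑ (T_(1) · s) # T_(2) V` the marked node is in `T_(1)`, where the Leibnitz
rule of `R` kills the defect, or in `T_(2)`, where grafting onto `V` gives defects of larger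
contexts. -/
theorem smashMul_mem_right (hρ : IsLeibnitz ρ) (x b : Smash k R (Derivation k R R))
    (hx : x ∈ leibnitzIdeal ρ) : smashMul ρ x b ∈ leibnitzIdeal ρ := by
  induction b using TensorProduct.induction_on with
  | zero => simp
  | add b c hb hc => simpa using add_mem hb hc
  | tmul s g =>
    refine KLT.apply_mem (smashMul ρ x ∘ₗ TensorProduct.mk k R _ s)
      (p := (leibnitzIdeal ρ).restrictScalars k) (fun V => ?_) g
    suffices h : leibnitzIdeal ρ ≤ (leibnitzIdeal ρ).comap (smashMulRight ρ (s ⊗ₜ KLT.tree k V))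
      from h hx
    refine leibnitzIdeal_le fun c C r E => ?_
    rw [Submodule.mem_comap, ← defect_map]
    have h : ∀ T, smashMulRight ρ (s ⊗ₜ KLT.tree k V) (1 ⊗ₜ[k] KLT.tree k T) =
        T.splitSum fun A B => ρ (KLT.tree k A) s ⊗ₜ (KLT.tree k B * KLT.tree k V) := by
      intro T
      rw [← hopfMul_tmul, ← one_smul R (hopfMul ρ _ _)]
      rfl
    simp only [h, defect_splitSum]
    refine c.splitSum_mem fun c' Q => add_mem ?_ ?_
    · have := defect_map (ρ := ρ) (LinearMap.toSpanSingleton R _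
        ((1 : R) ⊗ₜ[k] (KLT.tree k Q * KLT.tree k V))) (fun T => ρ (KLT.tree k T) s) c' C r E
      simp only [LinearMap.toSpanSingleton_apply, ← tree_tmul_eq, defect_act_eq_zero hρ,
        zero_smul] at this
      rw [this]
      exact zero_mem _
    · have := defect_map (ρ := ρ) (LinearMap.lsmul R (Smash k R (Derivation k R R))
        (ρ (KLT.tree k Q) s)) (fun T => (1 : R) ⊗ₜ[k] (KLT.tree k T * KLT.tree k V)) c' C r E
      simp only [LinearMap.lsmul_apply, ← tree_tmul_eq] at this
      rw [this]
      refine Submodule.smul_mem _ _ ?_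
      have h' : ∀ T, (1 : R) ⊗ₜ[k] (KLT.tree k T * KLT.tree k V) =
          graftSum T V fun U => (1 : R) ⊗ₜ[k] KLT.tree k U := by
        intro T
        rw [KLT.tree_mul_tree]
        exact map_graftSum (TensorProduct.mk k R _ 1) T V _
      simp only [h']
      exact defect_graftSum_mem defect_mem_leibnitzIdeal V c' C r E

theorem smashCounit_eq_zero (x : Smash k R (Derivation k R R)) (hx : x ∈ leibnitzIdeal ρ) :
    smashCounit x = 0 := by
  suffices h : leibnitzIdeal ρ ≤ LinearMap.ker (smashCounit (k := k) (R := R)) from h hx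
  refine leibnitzIdeal_le fun c C r E => ?_
  rw [LinearMap.mem_ker, ← defect_map]
  have h : ∀ T : LTree (Derivation k R R), smashCounit ((1 : R) ⊗ₜ[k] KLT.tree k T) =
      algebraMap k R (KLT.counit (KLT.tree k T)) := by
    intro T
    simp [smashCounit]
  simp [defect, h, KLT.counit_of_ne (TreeCtx.fill_ne_nil _ _ _)]

/-- The defect of the coproduct is a sum of tensors with a defect in one factor, and `π` kills that
factor. Scalars come out of either factor since the tensor product is over `R`. -/
theorem map_smashComul_eq_zero (x : Smash k R (Derivation k R R)) (hx : x ∈ leibnitzIdeal ρ) :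
    TensorProduct.map (leibnitzIdeal ρ).mkQ (leibnitzIdeal ρ).mkQ (smashComul x) = 0 := by
  set π := (leibnitzIdeal ρ).mkQ with hπ
  suffices h : leibnitzIdeal ρ ≤ LinearMap.ker (TensorProduct.map π π ∘ₗ smashComul) from h hx
  refine leibnitzIdeal_le fun c C r E => ?_
  rw [LinearMap.mem_ker, ← defect_map]
  have h : ∀ T : LTree (Derivation k R R),
      (TensorProduct.map π π ∘ₗ smashComul) ((1 : R) ⊗ₜ[k] KLT.tree k T) = T.splitSum fun P Q =>
        π (1 ⊗ₜ[k] KLT.tree k P) ⊗ₜ[R] π (1 ⊗ₜ[k] KLT.tree k Q) := by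
    intro T
    simp [smashComul, KLT.comul_tree, map_splitSum]
  have h₀ : ∀ c C r E, defect ρ (fun T => π ((1 : R) ⊗ₜ[k] KLT.tree k T)) c C r E = 0 := by
    intro c C r E
    rw [defect_map, hπ, Submodule.mkQ_apply, Submodule.Quotient.mk_eq_zero]
    exact defect_mem_leibnitzIdeal c C r E
  simp only [h, defect_splitSum]
  have h₁ : ∀ (y : _ ⧸ leibnitzIdeal ρ) c, defect ρ (fun T => π ((1 : R) ⊗ₜ[k] KLT.tree k T) ⊗ₜ[R] y) c C r E = 0 := by
    intro y c
    have := defect_map (ρ := ρ) ((TensorProduct.mk R (_ ⧸ leibnitzIdeal ρ) _).flip y)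
      (fun T => π ((1 : R) ⊗ₜ[k] KLT.tree k T)) c C r E
    rwa [h₀, map_zero] at this
  have h₂ : ∀ (y : _ ⧸ leibnitzIdeal ρ) c, defect ρ (fun T => y ⊗ₜ[R] π ((1 : R) ⊗ₜ[k] KLT.tree k T)) c C r E = 0 := by
    intro y c
    have := defect_map (ρ := ρ) (TensorProduct.mk R _ (_ ⧸ leibnitzIdeal ρ) y)
      (fun T => π ((1 : R) ⊗ₜ[k] KLT.tree k T)) c C r E
    rwa [h₀, map_zero] at this
  simp only [h₁, h₂, add_zero, TreeCtx.splitSum_zero]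

end Ideal

/-! ## The antiproduct -/

section Antiproduct

variable {k R D : Type*} [Field k] [CommRing R] [Algebra k R] {ρ : KLT k D →ₗ[k] R →ₗ[k] R}

theorem act_act_antipode (hρ : IsModuleAlgebra ρ) (T : LTree D) (r : R) :
    (T.splitSum fun P Q => ρ (KLT.tree k P) (ρ (KLT.antipodeTree Q) r)) =
      KLT.counit (KLT.tree k T) • r := by
  simp only [← hρ.mul_act]
  refine (map_splitSum (ρ.flip r) T _).symm.trans ?_
  rw [KLT.mul_antipode, map_smul, LinearMap.flip_apply, ← KLT.one_def, hρ.one_act]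

theorem hopfMul_nil (hρ : IsModuleAlgebra ρ) (x : Smash k R D) :
    hopfMul ρ (KLT.tree k nil) x = x := by
  induction x using TensorProduct.induction_on with
  | zero => simp
  | add x y hx hy => rw [map_add, hx, hy]
  | tmul s g => rw [hopfMul_tmul, splitSum_nil, ← KLT.one_def, hρ.one_act, KLT.one_def,
      KLT.tree_nil_mul]

/-- Coassociativity brings the two parts acting on `r` together, and after a swap they cancel by the
antipode identity. -/
theorem splitSum_act_act_antipode_tmul (hρ : IsModuleAlgebra ρ) (T : LTree D) (r : R)
    (f : LTree D → KLT k D) :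
    (T.splitSum fun P Q => Q.splitSum fun A B =>
      ρ (KLT.tree k A) (ρ (KLT.antipodeTree P) r) ⊗ₜ[k] f B) = r ⊗ₜ f T := by
  rw [← LTree.splitSum_assoc T fun P A B =>
    ρ (KLT.tree k A) (ρ (KLT.antipodeTree P) r) ⊗ₜ[k] f B]
  have h : ∀ P Q : LTree D, (P.splitSum fun A B =>
      ρ (KLT.tree k B) (ρ (KLT.antipodeTree A) r) ⊗ₜ[k] f Q) =
      KLT.counit (KLT.tree k P) • (r ⊗ₜ[k] f Q) := by
    intro P Q
    rw [TensorProduct.smul_tmul', ← act_act_antipode hρ, LTree.splitSum_swap]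
    exact (map_splitSum ((TensorProduct.mk k R _).flip (f Q)) P _).symm
  simp only [h]
  exact KLT.splitSum_counit_smul T _

/-- A left scalar is rewritten through right multiplications, the form in which the balancing
relations can carry it to the second tensor factor. -/
theorem splitSum_smashMul_antipode (hρ : IsModuleAlgebra ρ) (T : LTree D) (r : R) :
    (T.splitSum fun P Q => smashMul ρ (1 ⊗ₜ KLT.tree k P)
      (ρ (KLT.antipodeTree Q) r ⊗ₜ (1 : KLT k D))) = r ⊗ₜ KLT.tree k T := by
  simp only [smashMul_tmul, one_smul, hopfMul_tmul, KLT.one_def, KLT.mul_tree_nil]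
  rw [LTree.splitSum_swap, splitSum_act_act_antipode_tmul hρ T r (KLT.tree k)]

theorem map_antiproduct_tmul_tree {Q : Type*} [AddCommGroup Q] [Module k Q]
    (π : Smash k R D →ₗ[k] Q) (r : R) (T : LTree D) :
    BTensor.map ρ π (antiproduct ρ (r ⊗ₜ KLT.tree k T)) = T.splitSum fun A B =>
      (balancing ρ π).mkQ (π (r ⊗ₜ KLT.tree k A) ⊗ₜ π (1 ⊗ₜ KLT.antipodeTree B)) := by
  have h : antiproduct ρ (r ⊗ₜ KLT.tree k T) = (Submodule.mkQ _ ∘ₗ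
      TensorProduct.map LinearMap.id (TensorProduct.mk k R (KLT k D) 1 ∘ₗ KLT.antipode) ∘ₗ
      (TensorProduct.assoc k R (KLT k D) (KLT k D)).symm.toLinearMap ∘ₗ
      TensorProduct.mk k R _ r) (KLT.comul (KLT.tree k T)) := rfl
  rw [h, KLT.comul_tree, map_splitSum, map_splitSum]
  refine congrArg _ (funext₂ fun A B => ?_)
  simp only [LinearMap.comp_apply, TensorProduct.mk_apply, LinearEquiv.coe_coe,
    TensorProduct.assoc_symm_tmul, TensorProduct.map_tmul, LinearMap.id_apply, KLT.antipode_tree]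
  rfl

variable [SMul R D]

/-- The Leibnitz rule for a pairing of functions `p` and `q` on trees, of which the first one
satisfies it and the second one satisfies a twisted version of it. -/
theorem defect_pairing_eq_zero {M Z : Type*} [AddCommGroup M] [Module R M] [AddCommGroup Z]
    [Module R Z] (m : M →+ M →+ Z) (hm : ∀ (s : R) x y, m (s • x) y = s • m x y)
    (p q : LTree D → M) (hp : ∀ c C r E, defect ρ p c C r E = 0) (σ : LTree D → R → R)
    (hσ : ∀ (t : R) (T : LTree D) (U : LTree D), t • m (p T) (q U) =
      T.splitSum fun P Q => m (p P) (σ Q t • q U))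
    (hq : ∀ (c : TreeCtx D) (C : LTree D) (r : R) (E : D), q (c.fill (r • E) C) = c.splitSum fun c' Y =>
      C.splitSum fun P Q => σ Y (ρ (KLT.tree k P) r) • q (c'.fill E Q))
    (c : TreeCtx D) (C : LTree D) (r : R) (E : D) :
    defect ρ (fun T => T.splitSum fun A B => m (p A) (q B)) c C r E = 0 := by
  have h₁ : ∀ c y, defect ρ (fun T => m (p T) y) c C r E = 0 := by
    intro c y
    let L : M →ₗ[R] Z := { m.flip y with map_smul' := fun s x => hm s x y }
    have := defect_map (ρ := ρ) L p c C r E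
    rwa [hp, map_zero] at this
  rw [defect_splitSum]
  simp only [h₁, zero_add]
  simp only [defect, hσ]
  rw [TreeCtx.splitSum_sub, sub_eq_zero]
  simp only [hq, TreeCtx.map_splitSum, map_splitSum, LTree.splitSum_comm C]
  -- Both sides now cut a remainder `W` of the context into a part in the first factor and a part
  -- acting through `σ`; they differ only in the order of the two.
  rw [TreeCtx.splitSum_assoc c fun c' Y P => C.splitSum fun A B =>
    m (p P) (σ Y (ρ (KLT.tree k A) r) • q (c'.fill E B))]
  exact congrArg _ (funext₂ fun c' W => LTree.splitSum_swap W _)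

end Antiproduct

/-! ### The antipode and the antiproduct modulo the Leibnitz ideal. -/

section Ideal

variable {k R : Type*} [Field k] [CommRing R] [Algebra k R]
  {ρ : KLT k (Derivation k R R) →ₗ[k] R →ₗ[k] R}

theorem defect_mul_mem (hρ : IsLeibnitz ρ) (g : KLT k (Derivation k R R))
    (c : TreeCtx (Derivation k R R)) (C : LTree (Derivation k R R)) (r : R)
    (E : Derivation k R R) :
    defect ρ (fun T => (1 : R) ⊗ₜ[k] (KLT.tree k T * g)) c C r E ∈ leibnitzIdeal ρ := by
  have h := defect_map (ρ := ρ) (smashMulRight ρ ((1 : R) ⊗ₜ[k] g))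
    (fun T => (1 : R) ⊗ₜ[k] KLT.tree k T) c C r E
  have h' : ∀ T, smashMulRight ρ ((1 : R) ⊗ₜ[k] g) ((1 : R) ⊗ₜ[k] KLT.tree k T) =
      (1 : R) ⊗ₜ[k] (KLT.tree k T * g) := by
    intro T
    rw [← hopfMul_one_tmul hρ.toIsModuleAlgebra, ← one_smul R (hopfMul ρ _ _)]
    rfl
  simp only [h'] at h
  rw [h]
  exact smashMul_mem_right hρ _ _ (defect_mem_leibnitzIdeal c C r E)

/-- The twisted Leibnitz rule for the antipode, modulo the Leibnitz ideal. -/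
theorem antipode_sub_mem (hρ : IsLeibnitz ρ)
    (c : TreeCtx (Derivation k R R)) (C : LTree (Derivation k R R)) (r : R)
    (E : Derivation k R R) :
    (1 : R) ⊗ₜ[k] KLT.antipodeTree (c.fill (r • E) C) - (c.splitSum fun c' Y =>
      C.splitSum fun P Q => ρ (KLT.antipodeTree Y) (ρ (KLT.tree k P) r) ⊗ₜ[k]
        KLT.antipodeTree (c'.fill E Q)) ∈ leibnitzIdeal ρ := by
  have hρ' := hρ.toIsModuleAlgebra
  induction hn : c.length using Nat.strong_induction_on generalizing c with
  | _ n ih =>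
    subst hn
    set a : TreeCtx (Derivation k R R) → Smash k R (Derivation k R R) := fun c =>
      (1 : R) ⊗ₜ[k] KLT.antipodeTree (c.fill (r • E) C) - (c.splitSum fun c' Y =>
      C.splitSum fun P Q => ρ (KLT.antipodeTree Y) (ρ (KLT.tree k P) r) ⊗ₜ[k]
        KLT.antipodeTree (c'.fill E Q)) with ha
    -- Convolving the error `a` with the identity removes the twist: the actions of `X` and of
    -- `S(Y)` cancel (`h₂`), and `id * S = ε` trades the antipode of the filled context for that of
    -- the cut-off branches (`h₃`). What remains are defects of products, which lie in the ideal.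
    have h : (c.splitSum fun c' X => hopfMul ρ (KLT.tree k X) (a c')) ∈ leibnitzIdeal ρ := by
      have h₁ : ∀ c' X, hopfMul ρ (KLT.tree k X) (a c') =
          (1 : R) ⊗ₜ[k] (KLT.tree k X * KLT.antipodeTree (c'.fill (r • E) C)) -
          c'.splitSum fun c'' Y => X.splitSum fun A B => C.splitSum fun P Q =>
            ρ (KLT.tree k A) (ρ (KLT.antipodeTree Y) (ρ (KLT.tree k P) r)) ⊗ₜ[k]
              (KLT.tree k B * KLT.antipodeTree (c''.fill E Q)) := by
        intro c' X
        simp only [ha, map_sub, hopfMul_one_tmul hρ', TreeCtx.map_splitSum, map_splitSum,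
          hopfMul_tmul, LTree.splitSum_comm C]
      have h₂ : (c.splitSum fun c' X => c'.splitSum fun c'' Y => X.splitSum fun A B =>
          C.splitSum fun P Q =>
            ρ (KLT.tree k A) (ρ (KLT.antipodeTree Y) (ρ (KLT.tree k P) r)) ⊗ₜ[k]
              (KLT.tree k B * KLT.antipodeTree (c''.fill E Q))) =
          c.splitSum fun c' W => C.splitSum fun P Q =>
            ρ (KLT.tree k P) r ⊗ₜ[k] (KLT.tree k W * KLT.antipodeTree (c'.fill E Q)) := by
        rw [TreeCtx.splitSum_assoc c fun c' Y X => X.splitSum fun A B =>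
          C.splitSum fun P Q =>
            ρ (KLT.tree k A) (ρ (KLT.antipodeTree Y) (ρ (KLT.tree k P) r)) ⊗ₜ[k]
              (KLT.tree k B * KLT.antipodeTree (c'.fill E Q))]
        refine congrArg _ (funext₂ fun c' W => ?_)
        simp only [LTree.splitSum_comm _ C]
        refine congrArg _ (funext₂ fun P Q => ?_)
        exact splitSum_act_act_antipode_tmul hρ' W _ fun B =>
          KLT.tree k B * KLT.antipodeTree (c'.fill E Q)
      have h₃ : ∀ (s : R) F C, (c.splitSum fun c' X =>
          s ⊗ₜ[k] (KLT.tree k X * KLT.antipodeTree (c'.fill F C))) =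
          - c.splitSum fun c' X => s ⊗ₜ[k] (KLT.tree k (c'.fill F C) * KLT.antipodeTree X) := by
        intro s F C
        have := congrArg (TensorProduct.mk k R _ s) (KLT.mul_antipode (k := k) (c.fill F C))
        rw [KLT.counit_of_ne (c.fill_ne_nil F C), zero_smul, map_zero, TreeCtx.splitSum_fill,
          TreeCtx.splitSum_add, map_add, TreeCtx.map_splitSum, TreeCtx.map_splitSum] at this
        exact eq_neg_of_add_eq_zero_right this
      have h₄ : (c.splitSum fun c' X => hopfMul ρ (KLT.tree k X) (a c')) =
          - c.splitSum fun c' X => defect ρ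
            (fun T => (1 : R) ⊗ₜ[k] (KLT.tree k T * KLT.antipodeTree X)) c' C r E := by
        simp only [h₁, defect, ← tree_tmul_eq]
        rw [TreeCtx.splitSum_sub, TreeCtx.splitSum_sub, h₂, h₃, TreeCtx.splitSum_comm,
          TreeCtx.splitSum_comm]
        simp only [h₃]
        rw [LTree.splitSum_neg]
        abel
      rw [h₄]
      exact neg_mem (c.splitSum_mem fun c' X => defect_mul_mem hρ _ c' C r E)
    obtain ⟨m, hm, hlt⟩ := c.exists_splits_eq_cons
    rw [TreeCtx.splitSum, hm, Multiset.map_cons, Multiset.sum_cons, hopfMul_nil hρ'] at h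
    refine (add_mem_cancel_right (multiset_sum_mem _ fun x hx => ?_)).1 h
    -- A nontrivial cut leaves a shorter context, so induction and left stability of the ideal
    -- apply; only `a c` remains.
    obtain ⟨p, hp, rfl⟩ := Multiset.mem_map.1 hx
    exact hopfMul_mem hρ' _ (ih _ (hlt p hp) _ rfl)

/-- The relations defining `Q ⊗_r Q`, for a quotient `Q` of the smash product by an
`R`-submodule, are stable under the action of `R` on the first factor. -/
noncomputable def balancingSubmodule (ρ : KLT k (Derivation k R R) →ₗ[k] R →ₗ[k] R)
    (I : Submodule R (Smash k R (Derivation k R R))) :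
    Submodule R ((Smash k R (Derivation k R R) ⧸ I) ⊗[k] (Smash k R (Derivation k R R) ⧸ I)) where
  toAddSubmonoid := (balancing ρ (I.mkQ.restrictScalars k)).toAddSubmonoid
  smul_mem' s x hx := by
    change x ∈ balancing ρ (I.mkQ.restrictScalars k) at hx
    change s • x ∈ balancing ρ (I.mkQ.restrictScalars k)
    induction hx using Submodule.span_induction with
    | mem x hx =>
      obtain ⟨b, c, r, rfl⟩ := hx
      refine Submodule.subset_span ⟨s • b, c, r, ?_⟩
      simp only [smashMul_smul, LinearMap.restrictScalars_apply, map_smul, smul_sub,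
        TensorProduct.smul_tmul']
    | zero => simp
    | add x y _ _ hx hy => simpa using add_mem hx hy
    | smul t x _ hx =>
      rw [smul_comm]
      exact Submodule.smul_mem _ t hx

theorem map_antiproduct_eq_zero (hρ : IsLeibnitz ρ) (x : Smash k R (Derivation k R R))
    (hx : x ∈ leibnitzIdeal ρ) :
    BTensor.map ρ ((leibnitzIdeal ρ).mkQ.restrictScalars k) (antiproduct ρ x) = 0 := by
  set I := leibnitzIdeal ρ with hI
  set Q := Smash k R (Derivation k R R) ⧸ I
  set N := balancingSubmodule ρ I with hN
  let ι : KLT k (Derivation k R R) →ₗ[k] Q :=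
    I.mkQ.restrictScalars k ∘ₗ TensorProduct.mk k R (KLT k (Derivation k R R)) 1
  -- An `R`-linear lift of the composite to `Q ⊗[k] Q`. As the balancing relations form an
  -- `R`-submodule, it suffices to test the generators of the ideal.
  let F : Smash k R (Derivation k R R) →ₗ[R] Q ⊗[k] Q :=
    LinearMap.liftBaseChange R (TensorProduct.map ι (ι ∘ₗ KLT.antipode) ∘ₗ KLT.comul)
  have hF' : ∀ r T, F (r ⊗ₜ KLT.tree k T) =
      r • T.splitSum fun A B => ι (KLT.tree k A) ⊗ₜ[k] ι (KLT.antipodeTree B) := by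
    intro r T
    rw [LinearMap.liftBaseChange_tmul, LinearMap.comp_apply, KLT.comul_tree, map_splitSum]
    simp only [TensorProduct.map_tmul, LinearMap.comp_apply, KLT.antipode_tree]
  have hF : BTensor.map ρ (I.mkQ.restrictScalars k) ∘ₗ antiproduct ρ =
      Submodule.mkQ _ ∘ₗ F.restrictScalars k := by
    refine TensorProduct.ext (LinearMap.ext fun r => KLT.hom_ext fun T => ?_)
    change BTensor.map ρ _ (antiproduct ρ (r ⊗ₜ KLT.tree k T)) =
      Submodule.mkQ _ (F (r ⊗ₜ KLT.tree k T))
    rw [map_antiproduct_tmul_tree, hF', smul_splitSum, map_splitSum]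
    refine congrArg _ (funext₂ fun A B => ?_)
    rw [tree_tmul_eq r, LinearMap.restrictScalars_apply, map_smul]
    rfl
  suffices h : I ≤ N.comap F by
    have := LinearMap.congr_fun hF x
    simp only [LinearMap.comp_apply] at this
    rw [this]
    exact (Submodule.Quotient.mk_eq_zero _).2 (h hx)
  refine leibnitzIdeal_le fun c C r E => ?_
  let m : Q →+ Q →+ (Q ⊗[k] Q) ⧸ N := AddMonoidHom.mk' (fun x =>
    N.mkQ.toAddMonoidHom.comp (TensorProduct.mk k Q Q x).toAddMonoidHom) fun x y => by
      ext z
      simp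
  have h := defect_pairing_eq_zero (ρ := ρ) m (fun s x y => rfl) (fun T => ι (KLT.tree k T))
    (fun T => ι (KLT.antipodeTree T)) ?_ (fun T t => ρ (KLT.antipodeTree T) t) ?_ ?_ c C r E
  · rw [Submodule.mem_comap, ← defect_map, ← Submodule.Quotient.mk_eq_zero]
    rw [← Submodule.mkQ_apply, ← defect_map, ← h]
    congr 1
    funext T
    rw [hF', one_smul, map_splitSum]
    rfl
  · intro c C r E
    have h := defect_map (ρ := ρ) I.mkQ (fun T => (1 : R) ⊗ₜ[k] KLT.tree k T) c C r E
    rw [Submodule.mkQ_apply _ (defect _ _ _ _ _ _),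
      (Submodule.Quotient.mk_eq_zero _).2 (defect_mem_leibnitzIdeal c C r E)] at h
    exact h
  · intro t T U
    change N.mkQ (t • ι (KLT.tree k T) ⊗ₜ[k] ι (KLT.antipodeTree U)) = T.splitSum fun A B =>
      N.mkQ (ι (KLT.tree k A) ⊗ₜ[k] (ρ (KLT.antipodeTree B) t • ι (KLT.antipodeTree U)))
    -- The scalar `t` is written on the right of the first factor, so that the balancing relations
    -- can move it across.
    have h : t • ι (KLT.tree k T) = T.splitSum fun A B => I.mkQ
        (smashMul ρ (1 ⊗ₜ KLT.tree k A) (ρ (KLT.antipodeTree B) t ⊗ₜ (1 : KLT k _))) := by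
      rw [← map_splitSum, splitSum_smashMul_antipode hρ.toIsModuleAlgebra, tree_tmul_eq, map_smul]
      rfl
    rw [TensorProduct.smul_tmul', h]
    refine (map_splitSum (N.mkQ.toAddMonoidHom.comp
      ((TensorProduct.mk k Q Q).flip (ι (KLT.antipodeTree U))).toAddMonoidHom) T _).trans ?_
    refine congrArg _ (funext₂ fun A B => (Submodule.Quotient.eq N).2 ?_)
    exact Submodule.subset_span ⟨_, 1 ⊗ₜ KLT.antipodeTree U, _, rfl⟩
  · intro c C r E
    have h := (Submodule.Quotient.mk_eq_zero _).2 (antipode_sub_mem hρ c C r E)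
    rw [← Submodule.mkQ_apply, map_sub, sub_eq_zero] at h
    refine h.trans ?_
    simp only [TreeCtx.map_splitSum, map_splitSum]
    refine congrArg _ (funext₂ fun c' Y => congrArg _ (funext₂ fun P Q => ?_))
    rw [tree_tmul_eq, map_smul]
    rfl

end Ideal

end TreeHopf

theorem proposition5p3 {k R : Type*} [Field k] [CommRing R] [Algebra k R]
    (ρ : TreeHopf.KLT k (Derivation k R R) →ₗ[k] R →ₗ[k] R) (hρ : TreeHopf.IsLeibnitz ρ) :
    TreeHopf.IsHopfIdeal ρ (TreeHopf.leibnitzIdeal ρ) where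
  mul_mem_left := TreeHopf.smashMul_mem_left hρ.toIsModuleAlgebra
  mul_mem_right := TreeHopf.smashMul_mem_right hρ
  counit_eq_zero := TreeHopf.smashCounit_eq_zero
  comul_eq_zero := TreeHopf.map_smashComul_eq_zero
  antiproduct_eq_zero := TreeHopf.map_antiproduct_eq_zero hρ
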